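/- Let $n\ge 2$ and $d\ge 2$ be integers and put $\nu=\tfrac d2-1$. Let $p_n(\nu;x)$ denote the probability density function of the distance to the origin after $n$ independent steps in $\mathbb R^d$, each uniformly distributed on the unit sphere, and let $$W_n(\nu;s)=\int_0^\infty x^s\,p_n(\nu;x)\,\mathrm dx$$ be the associated moment function, for those $s\in\mathbb C$ for which the integral converges absolutely. Let $j_\nu$ be the normalized Bessel function $$j_\nu(x)=\Gamma(\nu+1)\sum_{m\ge0}\frac{(-x^2/4)^m}{m!\,\Gamma(m+\nu+1)}=\Gamma(\nu+1)\Big(\frac2x\Big)^{\nu}J_\nu(x).$$ Then $W_n(\nu;\cdot)$ has a unique meromorphic continuation to the half-plane $\operatorname{Re}s>-n(\nu+\tfrac12)$ (with removable singularities removed), which agrees with the integral above wherever in this half-plane it converges absolutely and is again denoted by $W_n(\nu;s)$. Moreover, for every integer $k\ge 0$ and every $s\in\mathbb C$ with $$k-n(\nu+\tfrac12)<\operatorname{Re}s<2k,$$ the integral $$\int_0^\infty x^{2k-s-1}\Big(-\frac1x\frac{\mathrm d}{\mathrm dx}\Big)^k j_\nu(x)^n\,\mathrm dx$$ (the operator being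 applied to the function $x\mapsto j_\nu(x)^n$) converges absolutely, and, provided that $s\notin\{-d-2m : m=0,1,2,\dots\}$ (the poles of $\Gamma(\tfrac s2+\nu+1)$), $$W_n(\nu;s)=\frac{2^{s-k+1}\,\Gamma\!\left(\frac s2+\nu+1\right)}{\Gamma(\nu+1)\,\Gamma\!\left(k-\frac s2\right)}\int_0^\infty x^{2k-s-1}\Big(-\frac1x\frac{\mathrm d}{\mathrm dx}\Big)^k j_\nu(x)^n\,\mathrm dx .$$ -/

import Mathlib

open MeasureTheory Set

noncomputable section

/-- The half-integer `ν = d / 2 - 1` attached to the dimension `d`. -/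
def nuOf (d : ℕ) : ℝ := (d : ℝ) / 2 - 1

/-- The normalized Bessel function of the first kind,
`j_ν(x) = Γ(ν+1) ∑_{m ≥ 0} (-x²/4)^m / (m! Γ(m+ν+1))`, that is `ν! (2/x)^ν J_ν(x)`. -/
def besselj (ν : ℝ) (x : ℝ) : ℝ :=
  Real.Gamma (ν + 1) *
    ∑' m : ℕ, (-x ^ 2 / 4) ^ m / ((Nat.factorial m : ℝ) * Real.Gamma ((m : ℝ) + ν + 1))

/-- The differential operator `g ↦ -(1/x) dg/dx`. -/
def besselD (g : ℝ → ℝ) : ℝ → ℝ := fun x => -(1 / x) * deriv g x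

/-- The unit sphere of `ℝ^d` (Euclidean norm). -/
abbrev UnitSphere (d : ℕ) : Type := Metric.sphere (0 : EuclideanSpace ℝ (Fin d)) 1

/-- The surface measure on the unit sphere of `ℝ^d`. -/
def surfaceMeasure (d : ℕ) : Measure (UnitSphere d) :=
  (volume : Measure (EuclideanSpace ℝ (Fin d))).toSphere

/-- The uniform distribution on the unit sphere of `ℝ^d`: normalized surface measure. -/
def uniformSphere (d : ℕ) : Measure (UnitSphere d) :=
  (surfaceMeasure d univ)⁻¹ • surfaceMeasure d

/-- The joint law of `n` independent uniformly distributed unit steps in `ℝ^d`. -/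
def walkMeasure (n d : ℕ) : Measure (Fin n → UnitSphere d) :=
  Measure.pi fun _ => uniformSphere d

instance (d : ℕ) : IsFiniteMeasure (surfaceMeasure d) := by
  unfold surfaceMeasure; infer_instance

instance (d : ℕ) : IsFiniteMeasure (uniformSphere d) := by
  refine ⟨?_⟩
  rw [uniformSphere, Measure.smul_apply, smul_eq_mul]
  exact (ENNReal.inv_mul_le_one _).trans_lt ENNReal.one_lt_top

/-- The distance to the origin after the `n` steps `ω 0, …, ω (n - 1)`. -/
def walkDist (n d : ℕ) (ω : Fin n → UnitSphere d) : ℝ :=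
  ‖∑ i, (ω i : EuclideanSpace ℝ (Fin d))‖

/-- `p_n(ν; x)`: the probability density function, with respect to Lebesgue measure, of the
distance to the origin after `n` steps in `ℝ^d`. -/
def walkDensity (n d : ℕ) (x : ℝ) : ℝ :=
  (pdf (walkDist n d) (walkMeasure n d) volume x).toReal

/-- The integrand `x^s p_n(ν; x)` of the moments. -/
def momentIntegrand (n d : ℕ) (s : ℂ) (x : ℝ) : ℂ := (x : ℂ) ^ s * (walkDensity n d x : ℂ)

/-- The open half-plane `Re s > -n (ν + 1/2)`. It contains all the strips
`k - n (ν + 1/2) < Re s < 2k`, for `k = 0, 1, 2, …`. -/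
def momentHalfPlane (n d : ℕ) : Set ℂ :=
  {s : ℂ | -((n : ℝ) * (nuOf d + 1 / 2)) < s.re}

/-- `W` is, on the half-plane `Re s > -n (ν + 1/2)`, the moment function `W_n(ν; s)`: it equals
`∫_0^∞ x^s p_n(ν; x) dx` wherever this integral converges absolutely, and it is meromorphic.
The normal form fills in removable singularities, and gives `W` the value `0` at poles. There is
at most one such function on the half-plane. -/
def IsMomentFunction (n d : ℕ) (W : ℂ → ℂ) : Prop :=
  MeromorphicNFOn W (momentHalfPlane n d) ∧
    ∀ s ∈ momentHalfPlane n d, IntegrableOn (momentIntegrand n d s) (Ioi 0) →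
      W s = ∫ x in Ioi (0 : ℝ), momentIntegrand n d s x

/-- The integrand `x^{2k-s-1} (-(1/x) d/dx)^k j_ν(x)^n`. -/
def besselIntegrand (n d k : ℕ) (s : ℂ) (x : ℝ) : ℂ :=
  (x : ℂ) ^ (2 * (k : ℂ) - s - 1) *
    (((besselD^[k]) (fun y => besselj (nuOf d) y ^ n) x : ℝ) : ℂ)

end

/-! Let X be the position after n steps and D = -(1/x) d/dx. The Fourier transform of the uniform
law on the sphere is j_ν, so independence gives E j_ν(x|X|) = j_ν(x)^n. Since D j_μ = j_{μ+1} /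
(2(μ+1)), applying D k times under the expectation gives D^k j_ν^n (x) = const · E[|X|^{2k}
j_{ν+k}(x|X|)]. Taking Mellin transforms at w = 2k - s would produce E|X|^s at once, but the Mellin
integral of an oscillating Bessel function need not converge absolutely, and Fubini fails.

The remedy is a Gaussian average in the scale. With weight ρ^{2μ+1} e^{-ρ²/2}, the function j_μ(tρ)
integrates to a multiple of e^{-t²/2}, so averaging turns the identity into one with a positive
right-hand side, E[|X|^{2k} e^{-x²|X|²/2}] (`integral_gaussian_iterate`). The Mellin transform of
the average is an explicit Gamma factor times that of D^k j_ν^n (`mellin_gaussAvg`). On the other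
side Tonelli yields both the finiteness of E|X|^s and its value, for Re s > -d within the strip
(`integrable_walkDist_cpow_and_integral`).

Convergence on the whole strip comes from D^k j_ν^n = O(x^{-k-n(ν+1/2)}): an energy estimate for
Bessel's equation gives the decay of j_μ, and the Leibniz rule for D transports it
(`decay_iterate_besselj_pow`).

To continue, the moments (the complex moment generating function of log|X|) are glued to the case k
= 0 of the formula. The identity theorem on the connected strip then gives every k
(`IsMomentFunction.eq_momentFormula`). -/

/-! ### The normalized Bessel series: derivative and recurrence. -/

/-- The coefficient `Γ(μ+1) / (m! Γ(m+μ+1))` of the normalized Bessel series. -/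
noncomputable def besselCoeff (μ : ℝ) (m : ℕ) : ℝ :=
  Real.Gamma (μ + 1) / ((m.factorial : ℝ) * Real.Gamma ((m : ℝ) + μ + 1))

/-- The normalized Bessel function as a function of `z = x ^ 2 / 4`. -/
noncomputable def besselSeries (μ : ℝ) (z : ℝ) : ℝ := ∑' m : ℕ, besselCoeff μ m * (-z) ^ m

theorem besselj_eq_series (μ x : ℝ) : besselj μ x = besselSeries μ (x ^ 2 / 4) := by
  unfold besselj besselSeries besselCoeff
  rw [← tsum_mul_left]
  refine tsum_congr fun m => ?_
  rw [neg_div]; ring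

/-- The argument `m + μ + 1` is at least 1, so the functional equation never decreases Γ. This is
what bounds the coefficients by those of the exponential series. -/
theorem gamma_shift_ge {μ : ℝ} (hμ : 0 ≤ μ) (m : ℕ) :
    Real.Gamma (μ + 1) ≤ Real.Gamma ((m : ℝ) + μ + 1) := by
  induction m with
  | zero => simp
  | succ m ih =>
    have h : (((m + 1 : ℕ) : ℝ) + μ + 1) = ((m : ℝ) + μ + 1) + 1 := by push_cast; ring
    have hm : (0 : ℝ) ≤ m := m.cast_nonneg
    rw [h, Real.Gamma_add_one (s := (m : ℝ) + μ + 1) (by positivity)]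
    have := Real.Gamma_pos_of_pos (show 0 < (m : ℝ) + μ + 1 by positivity)
    nlinarith

theorem besselCoeff_nonneg {μ : ℝ} (hμ : 0 ≤ μ) (m : ℕ) : 0 ≤ besselCoeff μ m := by
  unfold besselCoeff
  have h1 := Real.Gamma_pos_of_pos (show 0 < μ + 1 by positivity)
  have h2 := h1.trans_le (gamma_shift_ge hμ m)
  positivity

theorem besselCoeff_le {μ : ℝ} (hμ : 0 ≤ μ) (m : ℕ) :
    besselCoeff μ m ≤ 1 / (m.factorial : ℝ) := by
  unfold besselCoeff
  have h1 := Real.Gamma_pos_of_pos (show 0 < μ + 1 by positivity)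
  have h2 := gamma_shift_ge hμ m
  rw [div_le_div_iff₀ (by positivity) (by positivity)]
  have : (0 : ℝ) < m.factorial := by positivity
  nlinarith

theorem besselCoeff_zero {μ : ℝ} (hμ : 0 ≤ μ) : besselCoeff μ 0 = 1 := by
  have h1 := Real.Gamma_pos_of_pos (show 0 < μ + 1 by positivity)
  simp [besselCoeff, h1.ne']

theorem besselCoeff_succ {μ : ℝ} (hμ : 0 ≤ μ) (m : ℕ) :
    besselCoeff μ (m + 1) * ((m : ℝ) + 1) = besselCoeff (μ + 1) m / (μ + 1) := by
  unfold besselCoeff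
  have h1 := Real.Gamma_pos_of_pos (show 0 < μ + 1 by positivity)
  have h2 := Real.Gamma_pos_of_pos (show 0 < (m : ℝ) + (μ + 1) + 1 by positivity)
  rw [Real.Gamma_add_one (s := μ + 1) (by positivity), Nat.factorial_succ,
    show ((m + 1 : ℕ) : ℝ) + μ + 1 = (m : ℝ) + (μ + 1) + 1 by push_cast; ring]
  push_cast
  field_simp

theorem besselCoeff_raise {μ : ℝ} (hμ : 0 ≤ μ) (m : ℕ) :
    ((m : ℝ) + μ + 1) * besselCoeff (μ + 1) m = (μ + 1) * besselCoeff μ m := by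
  unfold besselCoeff
  have h1 := Real.Gamma_pos_of_pos (show 0 < μ + 1 by positivity)
  have h2 := Real.Gamma_pos_of_pos (show 0 < (m : ℝ) + μ + 1 by positivity)
  rw [Real.Gamma_add_one (s := μ + 1) (by positivity),
    show (m : ℝ) + (μ + 1) + 1 = (m : ℝ) + μ + 1 + 1 by ring,
    Real.Gamma_add_one (s := (m : ℝ) + μ + 1) (by positivity)]
  field_simp

theorem summable_besselSeries {μ : ℝ} (hμ : 0 ≤ μ) (z : ℝ) :
    Summable fun m : ℕ => besselCoeff μ m * (-z) ^ m := by
  refine Summable.of_norm_bounded (Real.summable_pow_div_factorial |z|) fun m => ?_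
  rw [norm_mul, norm_pow, norm_neg, Real.norm_eq_abs, Real.norm_eq_abs,
    abs_of_nonneg (besselCoeff_nonneg hμ m), div_eq_mul_inv, mul_comm, ← one_div]
  exact mul_le_mul_of_nonneg_left (besselCoeff_le hμ m) (by positivity)

theorem hasDerivAt_besselSeries {μ : ℝ} (hμ : 0 ≤ μ) (z : ℝ) :
    HasDerivAt (besselSeries μ) (-besselSeries (μ + 1) z / (μ + 1)) z := by
  set g' : ℕ → ℝ → ℝ := fun m y => besselCoeff μ m * ((m : ℝ) * (-y) ^ (m - 1) * (-1))
  -- Bound for the differentiated terms on the ball of radius `|z| + 1`; shifted by one index it is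
  -- the exponential series.
  set u : ℕ → ℝ := fun m => 1 / (m.factorial : ℝ) * ((m : ℝ) * (|z| + 1) ^ (m - 1))
  have hu : Summable u := by
    rw [← summable_nat_add_iff 1]
    refine (Real.summable_pow_div_factorial (|z| + 1)).congr fun m => ?_
    simp only [u, Nat.factorial_succ, Nat.add_sub_cancel]
    push_cast
    field_simp
  have key : HasDerivAt (fun y => ∑' m, besselCoeff μ m * (-y) ^ m) (∑' m, g' m z) z := by
    refine hasDerivAt_tsum_of_isPreconnected (t := Metric.ball 0 (|z| + 1)) (y₀ := 0) hu
      Metric.isOpen_ball (convex_ball _ _).isPreconnected ?_ ?_ ?_ ?_ ?_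
    · intro m y _
      exact (((hasDerivAt_neg y).pow m).const_mul (besselCoeff μ m)).congr_deriv (by simp [g'])
    · intro m y hy
      have hy' : |y| ≤ |z| + 1 := by
        have := Metric.mem_ball.1 hy
        rw [dist_zero_right, Real.norm_eq_abs] at this
        exact this.le
      simp only [g', u, norm_mul, norm_pow, norm_neg, norm_one, mul_one, Real.norm_eq_abs,
        abs_of_nonneg (besselCoeff_nonneg hμ m), Nat.abs_cast]
      gcongr
      exact besselCoeff_le hμ m
    · simp; positivity
    · exact summable_besselSeries hμ 0
    · simp
  refine key.congr_deriv ?_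
  have hs : Summable fun m => g' m z := by
    refine Summable.of_norm_bounded hu fun m => ?_
    simp only [g', u, norm_mul, norm_pow, norm_neg, norm_one, mul_one, Real.norm_eq_abs,
        abs_of_nonneg (besselCoeff_nonneg hμ m), Nat.abs_cast]
    gcongr
    · exact besselCoeff_le hμ m
    · linarith
  rw [hs.tsum_eq_zero_add, besselSeries, ← tsum_neg, ← tsum_div_const]
  simp only [g', Nat.cast_zero, zero_mul, mul_zero, zero_add]
  refine tsum_congr fun m => ?_
  have := besselCoeff_succ hμ m
  push_cast [Nat.add_sub_cancel]
  linear_combination (-(-z) ^ m) * this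

/-- Comparison of the coefficients of `z ^ (m + 1)`, all multiples of `besselCoeff (μ + 1) (m + 1)`.
It is the form in which Bessel's differential equation enters. -/
theorem besselSeries_recurrence {μ : ℝ} (hμ : 0 ≤ μ) (z : ℝ) :
    besselSeries (μ + 1) z - z * besselSeries (μ + 2) z / ((μ + 1) * (μ + 2)) =
      besselSeries μ z := by
  have h1 := summable_besselSeries (μ := μ + 1) (by positivity) z
  have h2 := summable_besselSeries (μ := μ + 2) (by positivity) z
  have h0 := summable_besselSeries hμ z
  unfold besselSeries
  rw [h1.tsum_eq_zero_add, h0.tsum_eq_zero_add, mul_div_right_comm, ← tsum_mul_left, add_sub_assoc,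
    ← Summable.tsum_sub ((summable_nat_add_iff 1).2 h1) (h2.mul_left _)]
  rw [besselCoeff_zero hμ, besselCoeff_zero (by positivity : 0 ≤ μ + 1)]
  congr 1
  refine tsum_congr fun m => ?_
  have e1 := besselCoeff_raise hμ (m + 1)
  have e2 := besselCoeff_succ (μ := μ + 1) (by positivity) m
  rw [show μ + 1 + 1 = μ + 2 by ring] at e2
  have e2' : besselCoeff (μ + 2) m / (μ + 2) = besselCoeff (μ + 1) (m + 1) * ((m : ℝ) + 1) := e2.symm
  have e1' : besselCoeff μ (m + 1) = ((m : ℝ) + 1 + μ + 1) * besselCoeff (μ + 1) (m + 1) / (μ + 1) := by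
    push_cast at e1
    rw [e1]; field_simp
  rw [e1', pow_succ]
  have e3 : besselCoeff (μ + 2) m = besselCoeff (μ + 1) (m + 1) * ((m : ℝ) + 1) * (μ + 2) := by
    rw [← e2']; field_simp
  rw [e3]
  field_simp
  ring

theorem hasDerivAt_besselj {μ : ℝ} (hμ : 0 ≤ μ) (x : ℝ) :
    HasDerivAt (besselj μ) (-(x / (2 * (μ + 1))) * besselj (μ + 1) x) x := by
  have h1 : HasDerivAt (fun y : ℝ => y ^ 2 / 4) (x / 2) x :=
    ((hasDerivAt_pow 2 x).div_const 4).congr_deriv (by push_cast; ring)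
  have h2 := (hasDerivAt_besselSeries hμ (x ^ 2 / 4)).comp x h1
  have : besselj μ = besselSeries μ ∘ fun y : ℝ => y ^ 2 / 4 := by
    ext y; exact besselj_eq_series μ y
  rw [this]
  refine h2.congr_deriv ?_
  rw [besselj_eq_series]
  field_simp

theorem continuous_besselj {μ : ℝ} (hμ : 0 ≤ μ) : Continuous (besselj μ) :=
  continuous_iff_continuousAt.2 fun x => (hasDerivAt_besselj hμ x).continuousAt

theorem besselj_recurrence {μ : ℝ} (hμ : 0 ≤ μ) (x : ℝ) :
    besselj (μ + 1) x - x ^ 2 * besselj (μ + 2) x / (4 * ((μ + 1) * (μ + 2))) = besselj μ x := by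
  rw [besselj_eq_series, besselj_eq_series, besselj_eq_series, ← besselSeries_recurrence hμ]
  field_simp

/-- The operator `-(1/x) d/dx` raises the index of the normalized Bessel function. -/
theorem besselD_besselj {μ : ℝ} (hμ : 0 ≤ μ) {x : ℝ} (hx : x ≠ 0) :
    besselD (besselj μ) x = besselj (μ + 1) x / (2 * (μ + 1)) := by
  rw [besselD, (hasDerivAt_besselj hμ x).deriv]
  field_simp

/-- The derivative of `x ↦ j_μ'(x)`: Bessel's differential equation. -/
theorem hasDerivAt_deriv_besselj {μ : ℝ} (hμ : 0 ≤ μ) {x : ℝ} (hx : x ≠ 0) :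
    HasDerivAt (fun y => -(y / (2 * (μ + 1))) * besselj (μ + 1) y)
      (-besselj μ x - (2 * μ + 1) / x * (-(x / (2 * (μ + 1))) * besselj (μ + 1) x)) x := by
  have h := (((hasDerivAt_id x).div_const (2 * (μ + 1))).neg).mul
    (hasDerivAt_besselj (μ := μ + 1) (by positivity) x)
  refine h.congr_deriv ?_
  rw [← besselj_recurrence hμ x, show μ + 1 + 1 = μ + 2 by ring]
  simp only [Pi.neg_apply, id]
  field_simp
  ring

/-! ### Decay of the normalized Bessel function. -/

/-- A Lyapunov function for Bessel's differential equation. -/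
noncomputable def besselEnergy (μ x : ℝ) : ℝ :=
  x ^ (2 * (μ + 1 / 2)) *
    ((-(x / (2 * (μ + 1))) * besselj (μ + 1) x + (μ + 1 / 2) * besselj μ x / x) ^ 2 +
      besselj μ x ^ 2) * Real.exp (|(μ + 1 / 2) * (μ - 1 / 2)| / x)

/-- With a = μ + 1/2, the function u = x^a j_μ satisfies u'' + u = a(a-1) u / x², and the energy is
(u'² + u²) e^{K/x} with K = |a(a-1)|. The derivative of u'² + u² is 2a(a-1) u u' / x² ≤ K (u² + u'²)
/ x², which the exponential factor absorbs. -/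
theorem hasDerivAt_besselEnergy {μ : ℝ} (hμ : 0 ≤ μ) {x : ℝ} (hx : 0 < x) :
    ∃ D ≤ 0, HasDerivAt (besselEnergy μ) D x := by
  set a := μ + 1 / 2 with ha
  set K := |a * (μ - 1 / 2)| with hK
  set j := besselj μ x with hj
  set p := -(x / (2 * (μ + 1))) * besselj (μ + 1) x with hp
  have d1 : HasDerivAt (fun y : ℝ => y ^ (2 * a)) (2 * a * (x ^ (2 * a) / x)) x := by
    refine (Real.hasDerivAt_rpow_const (Or.inl hx.ne')).congr_deriv ?_
    rw [Real.rpow_sub_one hx.ne']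
  have d2 : HasDerivAt (besselj μ) p x := hasDerivAt_besselj hμ x
  have d3 := hasDerivAt_deriv_besselj hμ hx.ne'
  have d4 := (d3.add ((d2.const_mul a).div (hasDerivAt_id x) hx.ne'))
  have d5 : HasDerivAt (fun y : ℝ => Real.exp (K / y)) (Real.exp (K / x) * (-K / x ^ 2)) x := by
    have := ((hasDerivAt_const x K).div (hasDerivAt_id x) hx.ne').exp
    refine this.congr_deriv ?_
    simp
  have d6 := (d1.mul ((d4.pow 2).add (d2.pow 2))).mul d5
  refine ⟨_, ?_, d6⟩
  simp only [Pi.add_apply, Pi.mul_apply, Pi.div_apply, Pi.pow_apply, id, ← hp, ← hj]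
  have hq : 0 < x ^ (2 * a) := by positivity
  have he : 0 < Real.exp (K / x) := by positivity
  generalize x ^ (2 * a) = q at hq ⊢
  generalize Real.exp (K / x) = e at he ⊢
  set w := p + a * j / x with hw
  have hpw : p = w - a * j / x := by rw [hw]; ring
  have : 2 * μ + 1 = 2 * a := by rw [ha]; ring
  rw [this]
  have hb : a * (μ - 1 / 2) = a * (a - 1) := by rw [ha]; ring
  rw [hb] at hK
  have hmain : 2 * (a * (a - 1)) * (w * j) ≤ K * (w ^ 2 + j ^ 2) := by
    calc 2 * (a * (a - 1)) * (w * j) ≤ |2 * (a * (a - 1)) * (w * j)| := le_abs_self _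
      _ = K * (2 * |w * j|) := by rw [abs_mul, abs_mul, ← hK, abs_two]; ring
      _ ≤ K * (w ^ 2 + j ^ 2) := by
        have : 2 * |w * j| ≤ w ^ 2 + j ^ 2 := by
          rw [abs_mul, ← sq_abs w, ← sq_abs j]; nlinarith [sq_nonneg (|w| - |j|)]
        exact mul_le_mul_of_nonneg_left this (by rw [hK]; positivity)
  have : q * e * (2 * (a * (a - 1)) * (w * j) - K * (w ^ 2 + j ^ 2)) / x ^ 2 ≤ 0 := by
    apply div_nonpos_of_nonpos_of_nonneg _ (by positivity)
    exact mul_nonpos_of_nonneg_of_nonpos (by positivity) (by linarith)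
  refine le_of_eq_of_le ?_ this
  clear_value w
  rw [hpw]
  field_simp
  ring

theorem besselEnergy_le {μ : ℝ} (hμ : 0 ≤ μ) {x : ℝ} (hx : 1 ≤ x) :
    besselEnergy μ x ≤ besselEnergy μ 1 := by
  have h : AntitoneOn (besselEnergy μ) (Ici 1) := by
    have hd : ∀ y ∈ Ici (1 : ℝ), ∃ D ≤ 0, HasDerivAt (besselEnergy μ) D y := fun y hy =>
      hasDerivAt_besselEnergy hμ (lt_of_lt_of_le one_pos hy)
    refine antitoneOn_of_deriv_nonpos (convex_Ici 1) ?_ ?_ ?_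
    · intro y hy
      obtain ⟨D, -, h⟩ := hd y hy
      exact h.continuousAt.continuousWithinAt
    · intro y hy
      obtain ⟨D, -, h⟩ := hd y (interior_subset hy)
      exact h.differentiableAt.differentiableWithinAt
    · intro y hy
      obtain ⟨D, h0, h⟩ := hd y (interior_subset hy)
      rwa [h.deriv]
  exact h (mem_Ici.2 le_rfl) hx hx

/-- The normalized Bessel function `j_μ` is `O(x ^ (-μ - 1/2))`. -/
theorem besselj_decay {μ : ℝ} (hμ : 0 ≤ μ) :
    ∃ C, 0 ≤ C ∧ ∀ x, 0 ≤ x → |besselj μ x| ≤ C * (1 + x) ^ (-(μ + 1 / 2)) := by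
  obtain ⟨M, hM⟩ := isCompact_Icc.exists_bound_of_continuousOn (s := Icc (0 : ℝ) 1)
    (continuous_besselj hμ).continuousOn
  have hM0 : 0 ≤ M := (norm_nonneg _).trans (hM 0 (by simp))
  set B := √(besselEnergy μ 1)
  refine ⟨max M B * 2 ^ (μ + 1 / 2), by positivity, fun x hx => ?_⟩
  rcases le_total x 1 with h1 | h1
  · have e : |besselj μ x| ≤ M := hM x ⟨hx, h1⟩
    have : (2 : ℝ) ^ (-(μ + 1 / 2)) ≤ (1 + x) ^ (-(μ + 1 / 2)) :=
      Real.rpow_le_rpow_of_nonpos (by positivity) (by linarith) (by linarith)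
    calc |besselj μ x| ≤ max M B := e.trans (le_max_left _ _)
      _ = max M B * 2 ^ (μ + 1 / 2) * 2 ^ (-(μ + 1 / 2)) := by
        rw [mul_assoc, ← Real.rpow_add two_pos]; simp
      _ ≤ _ := by gcongr
  · have hx0 : 0 < x := by linarith
    have e := besselEnergy_le hμ h1
    have e2 : (x ^ (μ + 1 / 2) * |besselj μ x|) ^ 2 ≤ besselEnergy μ 1 := by
      refine le_trans ?_ e
      unfold besselEnergy
      rw [mul_pow, sq_abs, ← Real.rpow_natCast (x ^ _), ← Real.rpow_mul hx0.le, mul_assoc,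
        show (μ + 1 / 2) * ((2 : ℕ) : ℝ) = 2 * (μ + 1 / 2) by push_cast; ring]
      refine mul_le_mul_of_nonneg_left ?_ (by positivity)
      have : 1 ≤ Real.exp (|(μ + 1 / 2) * (μ - 1 / 2)| / x) := Real.one_le_exp (by positivity)
      have h3 : besselj μ x ^ 2 ≤ ((-(x / (2 * (μ + 1))) * besselj (μ + 1) x +
        (μ + 1 / 2) * besselj μ x / x) ^ 2 + besselj μ x ^ 2) := by
          linarith [sq_nonneg (-(x / (2 * (μ + 1))) * besselj (μ + 1) x +
            (μ + 1 / 2) * besselj μ x / x)]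
      exact h3.trans (le_mul_of_one_le_right (by positivity) this)
    have e3 : x ^ (μ + 1 / 2) * |besselj μ x| ≤ B := Real.le_sqrt_of_sq_le e2
    have e4 : |besselj μ x| ≤ B * x ^ (-(μ + 1 / 2)) := by
      rw [Real.rpow_neg hx0.le, ← div_eq_mul_inv, le_div_iff₀ (by positivity)]
      linarith
    -- For `x ≥ 1` one has `x ≥ (1 + x) / 2`, the source of the factor `2 ^ (μ + 1 / 2)`.
    have e5 : x ^ (-(μ + 1 / 2)) ≤ ((1 + x) / 2) ^ (-(μ + 1 / 2)) :=
      Real.rpow_le_rpow_of_nonpos (by positivity) (by linarith) (by linarith)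
    rw [Real.div_rpow (by positivity) two_pos.le, Real.rpow_neg two_pos.le (μ + 1 / 2),
      div_inv_eq_mul] at e5
    calc |besselj μ x| ≤ B * x ^ (-(μ + 1 / 2)) := e4
      _ ≤ max M B * ((1 + x) ^ (-(μ + 1 / 2)) * 2 ^ (μ + 1 / 2)) := by
        gcongr
        exact le_max_right _ _
      _ = _ := by ring

/-! ### Decay classes stable under -(1/x) d/dx. -/

/-- Differentiable on the half-line and bounded there by a multiple of `(1 + x) ^ (-a)`. -/
def DecayBase (a : ℝ) (g : ℝ → ℝ) : Prop :=
  DifferentiableOn ℝ g (Ioi 0) ∧ ∃ C, 0 ≤ C ∧ ∀ x, 0 < x → |g x| ≤ C * (1 + x) ^ (-a)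

/-- The first `k` iterates of `-(1/x) d/dx` on `g` decay, gaining one power of `1 + x` each. -/
def BesselDecay : ℕ → ℝ → (ℝ → ℝ) → Prop
  | 0, a, g => DecayBase a g
  | k + 1, a, g => DecayBase a g ∧ BesselDecay k (a + 1) (besselD g)

theorem besselD_congr {g h : ℝ → ℝ} (e : EqOn g h (Ioi 0)) :
    EqOn (besselD g) (besselD h) (Ioi 0) := by
  intro x hx
  have : g =ᶠ[nhds x] h := Filter.eventuallyEq_of_mem (Ioi_mem_nhds hx) e
  simp only [besselD, this.deriv_eq]

theorem DecayBase.congr {a : ℝ} {g h : ℝ → ℝ} (hg : DecayBase a g) (e : EqOn g h (Ioi 0)) :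
    DecayBase a h := by
  obtain ⟨h1, C, hC, h2⟩ := hg
  refine ⟨h1.congr fun x hx => (e hx).symm, C, hC, fun x hx => ?_⟩
  rw [← e hx]; exact h2 x hx

theorem BesselDecay.congr {k : ℕ} : ∀ {a : ℝ} {g h : ℝ → ℝ}, BesselDecay k a g →
    EqOn g h (Ioi 0) → BesselDecay k a h := by
  induction k with
  | zero => exact fun hg e => DecayBase.congr hg e
  | succ k ih => exact fun hg e => ⟨hg.1.congr e, ih hg.2 (besselD_congr e)⟩

theorem BesselDecay.base {k : ℕ} {a : ℝ} {g : ℝ → ℝ} (h : BesselDecay k a g) : DecayBase a g := by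
  cases k with
  | zero => exact h
  | succ k => exact h.1

theorem BesselDecay.of_succ {k : ℕ} : ∀ {a : ℝ} {g : ℝ → ℝ}, BesselDecay (k + 1) a g →
    BesselDecay k a g := by
  induction k with
  | zero => exact fun h => h.1
  | succ k ih => exact fun h => ⟨h.1, ih h.2⟩

theorem DecayBase.add {a : ℝ} {g h : ℝ → ℝ} (hg : DecayBase a g) (hh : DecayBase a h) :
    DecayBase a (g + h) := by
  obtain ⟨g1, C, hC, g2⟩ := hg
  obtain ⟨h1, C', hC', h2⟩ := hh
  refine ⟨g1.add h1, C + C', by positivity, fun x hx => ?_⟩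
  calc |g x + h x| ≤ |g x| + |h x| := abs_add_le _ _
    _ ≤ _ := by linarith [g2 x hx, h2 x hx]

theorem DecayBase.mul {a b : ℝ} {g h : ℝ → ℝ} (hg : DecayBase a g) (hh : DecayBase b h) :
    DecayBase (a + b) (g * h) := by
  obtain ⟨g1, C, hC, g2⟩ := hg
  obtain ⟨h1, C', hC', h2⟩ := hh
  refine ⟨g1.mul h1, C * C', by positivity, fun x hx => ?_⟩
  have hx' : 0 < 1 + x := by linarith
  calc |g x * h x| = |g x| * |h x| := abs_mul _ _
    _ ≤ (C * (1 + x) ^ (-a)) * (C' * (1 + x) ^ (-b)) := by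
      gcongr
      · exact g2 x hx
      · exact h2 x hx
    _ = _ := by rw [neg_add, Real.rpow_add hx']; ring

theorem DecayBase.differentiableAt {a : ℝ} {g : ℝ → ℝ} (hg : DecayBase a g) {x : ℝ} (hx : 0 < x) :
    DifferentiableAt ℝ g x := hg.1.differentiableAt (Ioi_mem_nhds hx)

theorem BesselDecay.add {k : ℕ} : ∀ {a : ℝ} {g h : ℝ → ℝ}, BesselDecay k a g →
    BesselDecay k a h → BesselDecay k a (g + h) := by
  induction k with
  | zero => exact fun hg hh => DecayBase.add hg hh
  | succ k ih =>
    intro a g h hg hh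
    refine ⟨hg.1.add hh.1, (ih hg.2 hh.2).congr fun x hx => ?_⟩
    simp only [besselD, Pi.add_apply]
    rw [deriv_add (hg.1.differentiableAt hx) (hh.1.differentiableAt hx)]
    ring

/-- -(1/x) d/dx is a derivation. In each Leibniz term the differentiated factor gains the extra
power, and the other factor gives up one level of depth. -/
theorem BesselDecay.mul {k : ℕ} : ∀ {a b : ℝ} {g h : ℝ → ℝ}, BesselDecay k a g →
    BesselDecay k b h → BesselDecay k (a + b) (g * h) := by
  induction k with
  | zero => exact fun hg hh => DecayBase.mul hg hh
  | succ k ih =>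
    intro a b g h hg hh
    refine ⟨hg.1.mul hh.1, ?_⟩
    have e1 := ih hg.2 hh.of_succ
    have e2 := ih hg.of_succ hh.2
    rw [show a + 1 + b = a + b + 1 by ring] at e1
    rw [← add_assoc] at e2
    refine (e1.add e2).congr fun x hx => ?_
    simp only [besselD, Pi.add_apply, Pi.mul_apply]
    rw [deriv_mul (hg.1.differentiableAt hx) (hh.1.differentiableAt hx)]
    ring

theorem besselDecay_zero (k : ℕ) : ∀ a, BesselDecay k a (fun _ => 0) := by
  have h0 : ∀ a, DecayBase a (fun _ => 0) := fun a =>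
    ⟨differentiableOn_const 0, 0, le_rfl, fun x _ => by simp⟩
  induction k with
  | zero => exact h0
  | succ k ih => exact fun a => ⟨h0 a, (ih _).congr fun x _ => by simp [besselD]⟩

theorem besselDecay_const (k : ℕ) (c : ℝ) : BesselDecay k 0 (fun _ => c) := by
  have h0 : DecayBase 0 (fun _ => c) :=
    ⟨differentiableOn_const c, |c|, abs_nonneg c, fun x _ => by simp⟩
  cases k with
  | zero => exact h0
  | succ k => exact ⟨h0, (besselDecay_zero k _).congr fun x _ => by simp [besselD]⟩

/-- The operator maps j_μ to a multiple of j_{μ+1}, whose decay exponent is larger by exactly one.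
-/
theorem besselDecay_besselj (k : ℕ) : ∀ {μ : ℝ}, 0 ≤ μ →
    BesselDecay k (μ + 1 / 2) (besselj μ) := by
  have h0 : ∀ {μ : ℝ}, 0 ≤ μ → DecayBase (μ + 1 / 2) (besselj μ) := by
    intro μ hμ
    obtain ⟨C, hC, h⟩ := besselj_decay hμ
    exact ⟨fun x _ => (hasDerivAt_besselj hμ x).differentiableAt.differentiableWithinAt,
      C, hC, fun x hx => h x hx.le⟩
  induction k with
  | zero => exact h0
  | succ k ih =>
    intro μ hμ
    refine ⟨h0 hμ, ?_⟩
    have e := (besselDecay_const k (1 / (2 * (μ + 1)))).mul (ih (μ := μ + 1) (by positivity))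
    rw [show 0 + (μ + 1 + 1 / 2) = μ + 1 / 2 + 1 by ring] at e
    refine e.congr fun x hx => ?_
    rw [besselD_besselj hμ (ne_of_gt hx)]
    simp only [Pi.mul_apply]
    ring

theorem BesselDecay.pow {k : ℕ} {a : ℝ} {g : ℝ → ℝ} (hg : BesselDecay k a g) (n : ℕ) :
    BesselDecay k (n * a) (fun x => g x ^ n) := by
  induction n with
  | zero => simpa using besselDecay_const k 1
  | succ n ih =>
    have := ih.mul hg
    rw [show (n : ℝ) * a + a = ((n + 1 : ℕ) : ℝ) * a by push_cast; ring] at this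
    exact this.congr fun x _ => by simp [pow_succ]

theorem BesselDecay.iterate {k : ℕ} : ∀ {a : ℝ} {g : ℝ → ℝ}, BesselDecay k a g →
    DecayBase (a + k) (besselD^[k] g) := by
  induction k with
  | zero => intro a g hg; simpa using hg.base
  | succ k ih =>
    intro a g hg
    rw [Function.iterate_succ_apply]
    have := ih hg.2
    rwa [show a + 1 + (k : ℝ) = a + ((k + 1 : ℕ) : ℝ) by push_cast; ring] at this

/-- All the functions `(-(1/x) d/dx)^k j_ν^n` are `O(x ^ (-k - n (ν + 1/2)))` at infinity, and
bounded at the origin. -/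
theorem decay_iterate_besselj_pow {ν : ℝ} (hν : 0 ≤ ν) (n k : ℕ) :
    DecayBase (n * (ν + 1 / 2) + k) (besselD^[k] fun y => besselj ν y ^ n) :=
  ((besselDecay_besselj k hν).pow n).iterate

/-! ### Gaussian integrals and the Hankel transform of the Gaussian. -/

theorem integrableOn_rpow_mul_gaussian {q : ℝ} (hq : -1 < q) :
    IntegrableOn (fun x : ℝ => x ^ q * Real.exp (-(x ^ 2 / 2))) (Ioi 0) := by
  have := integrableOn_rpow_mul_exp_neg_mul_sq (b := 1 / 2) (by norm_num) hq
  refine this.congr_fun (fun x _ => ?_) measurableSet_Ioi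
  simp only
  congr 2; ring

theorem integral_rpow_mul_gaussian {q : ℝ} (hq : -1 < q) :
    ∫ x in Ioi (0 : ℝ), x ^ q * Real.exp (-(x ^ 2 / 2)) =
      2 ^ ((q - 1) / 2) * Real.Gamma ((q + 1) / 2) := by
  have := integral_rpow_mul_exp_neg_mul_rpow (p := 2) (b := 1 / 2) two_pos hq (by norm_num)
  rw [← setIntegral_congr_fun (g := fun x : ℝ => x ^ q * Real.exp (-(x ^ 2 / 2)))
    measurableSet_Ioi (fun x _ => ?_), this]
  · rw [one_div, Real.inv_rpow two_pos.le, ← Real.rpow_neg two_pos.le, neg_div, neg_neg,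
      ← Real.rpow_neg_one 2, ← Real.rpow_add two_pos]
    congr 2; ring
  · simp only [Real.rpow_two]
    congr 2; ring

/-- The Gaussian is, up to a constant, its own Hankel transform. -/
theorem integral_besselj_gaussian {μ : ℝ} (hμ : 0 ≤ μ) (t : ℝ) :
    ∫ ρ in Ioi (0 : ℝ), ρ ^ (2 * μ + 1) * Real.exp (-(ρ ^ 2 / 2)) * besselj μ (t * ρ) =
      2 ^ μ * Real.Gamma (μ + 1) * Real.exp (-(t ^ 2 / 2)) := by
  set F : ℕ → ℝ → ℝ := fun m ρ => besselCoeff μ m * (-(t ^ 2 / 4)) ^ m *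
    (ρ ^ (2 * μ + 1 + 2 * m) * Real.exp (-(ρ ^ 2 / 2)))
  have hq : ∀ m : ℕ, -1 < 2 * μ + 1 + 2 * (m : ℝ) := fun m => by
    have : (0 : ℝ) ≤ m := m.cast_nonneg
    linarith
  have hval : ∀ m : ℕ, ∫ ρ in Ioi (0 : ℝ), ρ ^ (2 * μ + 1 + 2 * (m : ℝ)) * Real.exp (-(ρ ^ 2 / 2)) =
      2 ^ μ * 2 ^ m * Real.Gamma ((m : ℝ) + μ + 1) := fun m => by
    rw [integral_rpow_mul_gaussian (hq m), ← Real.rpow_natCast, ← Real.rpow_add two_pos]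
    congr 2 <;> ring
  -- The Gamma value of the m-th Gaussian moment cancels the one in the Bessel coefficient, so
  -- integrating term by term leaves an exponential series. The norms sum to a similar series at `t
  -- ^ 2 / 2`, which justifies the exchange.
  have hc : ∀ m : ℕ, besselCoeff μ m * (2 ^ μ * 2 ^ m * Real.Gamma ((m : ℝ) + μ + 1)) =
      2 ^ μ * Real.Gamma (μ + 1) * (2 ^ m / m.factorial) := fun m => by
    have := (Real.Gamma_pos_of_pos (show 0 < μ + 1 by positivity)).trans_le (gamma_shift_ge hμ m)
    unfold besselCoeff
    field_simp
  have hsum := hasSum_integral_of_summable_integral_norm (F := F)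
    (μ := volume.restrict (Ioi 0)) (fun m => (integrableOn_rpow_mul_gaussian (hq m)).const_mul _) ?_
  · have e1 : ∀ m, ∫ ρ in Ioi (0 : ℝ), F m ρ =
        2 ^ μ * Real.Gamma (μ + 1) * ((-(t ^ 2 / 2)) ^ m / m.factorial) := fun m => by
      simp only [F]
      rw [integral_const_mul, hval, mul_right_comm, hc,
        show -(t ^ 2 / 2) = 2 * (-(t ^ 2 / 4)) by ring, mul_pow]
      ring
    simp only [e1] at hsum
    have e2 := (NormedSpace.expSeries_div_hasSum_exp (-(t ^ 2 / 2))).mul_left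
      (2 ^ μ * Real.Gamma (μ + 1))
    rw [← Real.exp_eq_exp_ℝ] at e2
    rw [← hsum.unique e2]
    refine setIntegral_congr_fun measurableSet_Ioi fun ρ hρ => ?_
    simp only [F]
    rw [besselj_eq_series, besselSeries, ← tsum_mul_left]
    refine tsum_congr fun m => ?_
    rw [Real.rpow_add (z := 2 * (m : ℝ)) hρ, show (ρ : ℝ) ^ (2 * (m : ℝ)) = (ρ ^ 2) ^ m by
      rw [← pow_mul, ← Real.rpow_natCast]; push_cast; rfl,
      show -((t * ρ) ^ 2 / 4) = -(t ^ 2 / 4) * ρ ^ 2 by ring, mul_pow]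
    ring
  · have e3 : ∀ m, ∫ ρ in Ioi (0 : ℝ), ‖F m ρ‖ =
        2 ^ μ * Real.Gamma (μ + 1) * ((t ^ 2 / 2) ^ m / m.factorial) := fun m => by
      rw [← setIntegral_congr_fun (f := fun ρ : ℝ => besselCoeff μ m * (t ^ 2 / 4) ^ m *
        (ρ ^ (2 * μ + 1 + 2 * (m : ℝ)) * Real.exp (-(ρ ^ 2 / 2)))) measurableSet_Ioi fun ρ hρ => ?_]
      · rw [integral_const_mul, hval, mul_right_comm, hc,
          show t ^ 2 / 2 = 2 * (t ^ 2 / 4) by ring, mul_pow]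
        ring
      · have : 0 ≤ ρ ^ (2 * μ + 1 + 2 * (m : ℝ)) := Real.rpow_nonneg (le_of_lt hρ) _
        simp only [F]
        rw [norm_mul, norm_mul, norm_pow, norm_neg, Real.norm_of_nonneg (besselCoeff_nonneg hμ m),
          Real.norm_of_nonneg (by positivity : 0 ≤ t ^ 2 / 4), Real.norm_of_nonneg (by positivity)]
    simp only [e3]
    exact (Real.summable_pow_div_factorial _).mul_left _

/-! ### Moments and Fourier transform of the uniform law on the sphere. -/

section
open scoped RealInnerProductSpace

/-- In polar coordinates the inner product power is homogeneous of degree `p`, so the integral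
splits into a spherical and a radial factor. -/
theorem integral_inner_pow_mul_gaussian_polar {d : ℕ} (hd : 1 ≤ d)
    (u : EuclideanSpace ℝ (Fin d)) (p : ℕ) :
    ∫ x : EuclideanSpace ℝ (Fin d), ⟪u, x⟫ ^ p * Real.exp (-(‖x‖ ^ 2 / 2)) =
      (∫ ω, ⟪u, (ω : EuclideanSpace ℝ (Fin d))⟫ ^ p ∂surfaceMeasure d) *
        ∫ r in Ioi (0 : ℝ), r ^ ((d : ℝ) - 1 + p) * Real.exp (-(r ^ 2 / 2)) := by
  have : Nonempty (Fin d) := ⟨⟨0, hd⟩⟩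
  have hdim : Module.finrank ℝ (EuclideanSpace ℝ (Fin d)) = d := by simp
  calc ∫ x : EuclideanSpace ℝ (Fin d), ⟪u, x⟫ ^ p * Real.exp (-(‖x‖ ^ 2 / 2))
      = ∫ x : ({(0)}ᶜ : Set (EuclideanSpace ℝ (Fin d))), ⟪u, x.1⟫ ^ p * Real.exp (-(‖x.1‖ ^ 2 / 2))
          ∂(volume.comap Subtype.val) := by
        rw [integral_subtype_comap (measurableSet_singleton _).compl
          fun x : EuclideanSpace ℝ (Fin d) ↦ ⟪u, x⟫ ^ p * Real.exp (-(‖x‖ ^ 2 / 2)), restrict_compl_singleton]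
    _ = ∫ z : UnitSphere d × Ioi (0 : ℝ), ⟪u, (z.1 : EuclideanSpace ℝ (Fin d))⟫ ^ p *
          ((z.2 : ℝ) ^ p * Real.exp (-((z.2 : ℝ) ^ 2 / 2)))
          ∂(surfaceMeasure d).prod (.volumeIoiPow (Module.finrank ℝ (EuclideanSpace ℝ (Fin d)) - 1)) := by
        have hm := (Measure.measurePreserving_homeomorphUnitSphereProd
          (volume : Measure (EuclideanSpace ℝ (Fin d)))).integral_comp
          (Homeomorph.measurableEmbedding _)
          fun z : UnitSphere d × Ioi (0 : ℝ) => ⟪u, (z.1 : EuclideanSpace ℝ (Fin d))⟫ ^ p *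
          ((z.2 : ℝ) ^ p * Real.exp (-((z.2 : ℝ) ^ 2 / 2)))
        rw [surfaceMeasure, ← hm]
        refine integral_congr_ae (Filter.Eventually.of_forall fun x => ?_)
        have hx : ‖(x : EuclideanSpace ℝ (Fin d))‖ ≠ 0 := norm_ne_zero_iff.2 x.2
        simp only [homeomorphUnitSphereProd_apply_snd_coe, homeomorphUnitSphereProd_apply_fst_coe]
        rw [inner_smul_right, mul_pow, inv_pow]
        field_simp
    _ = _ := by
        rw [integral_prod_mul (fun ω : UnitSphere d => ⟪u, (ω : EuclideanSpace ℝ (Fin d))⟫ ^ p)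
          (fun r : Ioi (0 : ℝ) => (r : ℝ) ^ p * Real.exp (-((r : ℝ) ^ 2 / 2)))]
        congr 1
        simp only [Measure.volumeIoiPow, ENNReal.ofReal]
        rw [integral_withDensity_eq_integral_smul, integral_subtype_comap measurableSet_Ioi
          fun a ↦ Real.toNNReal (a ^ (Module.finrank ℝ (EuclideanSpace ℝ (Fin d)) - 1)) •
            (a ^ p * Real.exp (-(a ^ 2 / 2))),
          setIntegral_congr_fun measurableSet_Ioi fun x hx ↦ ?_]
        · have hx' : 0 < x := hx
          rw [NNReal.smul_def, Real.coe_toNNReal _ (pow_nonneg hx'.le _), hdim, smul_eq_mul,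
            ← mul_assoc, ← pow_add, ← Real.rpow_natCast]
          push_cast [hd]
          rfl
        · exact (measurable_subtype_coe.pow_const _).real_toNNReal

/-- An orthonormal basis containing `u` turns the inner product into a coordinate, and the Gaussian
factorises over coordinates. -/
theorem integral_inner_pow_mul_gaussian {d : ℕ} (hd : 1 ≤ d)
    {u : EuclideanSpace ℝ (Fin d)} (hu : ‖u‖ = 1) (p : ℕ) :
    ∫ x : EuclideanSpace ℝ (Fin d), ⟪u, x⟫ ^ p * Real.exp (-(‖x‖ ^ 2 / 2)) =
      (∫ t : ℝ, t ^ p * Real.exp (-(t ^ 2 / 2))) * (∫ t : ℝ, Real.exp (-(t ^ 2 / 2))) ^ (d - 1) := by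
  set i₀ : Fin d := ⟨0, hd⟩
  obtain ⟨b, hb⟩ := Orthonormal.exists_orthonormalBasis_extension_of_card_eq (𝕜 := ℝ)
    (E := EuclideanSpace ℝ (Fin d)) (ι := Fin d) (by simp) (v := fun _ => u) (s := {i₀}) (by
      constructor
      · intro i; simpa using hu
      · intro i j hij; exact absurd (Subsingleton.elim i j) hij)
  have hb0 : b i₀ = u := hb i₀ (by simp)
  have e1 := (b.measurePreserving_repr_symm).integral_comp
    (b.repr.symm.toHomeomorph.measurableEmbedding)
    (fun x : EuclideanSpace ℝ (Fin d) => ⟪u, x⟫ ^ p * Real.exp (-(‖x‖ ^ 2 / 2)))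
  have e2 := (PiLp.volume_preserving_toLp (Fin d)).integral_comp
    (MeasurableEquiv.toLp 2 (Fin d → ℝ)).measurableEmbedding
    (fun x : EuclideanSpace ℝ (Fin d) => x i₀ ^ p * Real.exp (-(‖x‖ ^ 2 / 2)))
  have e3 : ∀ x, ⟪u, b.repr.symm x⟫ = x i₀ := by
    intro x
    rw [← hb0, ← b.repr_apply_apply, LinearIsometryEquiv.apply_symm_apply]
  simp only [e3, LinearIsometryEquiv.norm_map] at e1
  rw [← e1, ← e2]
  set h : Fin d → ℝ → ℝ := fun i t => (if i = i₀ then t ^ p else 1) * Real.exp (-(t ^ 2 / 2))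
  have e4 := integral_fintype_prod_volume_eq_prod h
  have e5 : ∀ x : Fin d → ℝ, ∏ i, h i (x i) = x i₀ ^ p * Real.exp (-(‖WithLp.toLp 2 x‖ ^ 2 / 2)) := by
    intro x
    simp only [h]
    rw [Finset.prod_mul_distrib, ← Real.exp_sum, EuclideanSpace.real_norm_sq_eq,
      Finset.prod_ite_eq' Finset.univ i₀]
    simp [Finset.sum_div]
  simp only [e5] at e4
  rw [e4, ← Finset.mul_prod_erase Finset.univ _ (Finset.mem_univ i₀)]
  refine congr_arg₂ _ (by simp [h]) ?_
  · rw [Finset.prod_congr rfl (g := fun _ => ∫ t : ℝ, Real.exp (-(t ^ 2 / 2)))]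
    · simp
    · intro i hi
      simp [h, Finset.ne_of_mem_erase hi]

theorem integral_pow_mul_gaussian_even (m : ℕ) :
    ∫ t : ℝ, t ^ (2 * m) * Real.exp (-(t ^ 2 / 2)) =
      2 * (2 ^ ((2 * (m : ℝ) - 1) / 2) * Real.Gamma ((2 * (m : ℝ) + 1) / 2)) := by
  have := integral_comp_abs (f := fun t : ℝ => t ^ (2 * m) * Real.exp (-(t ^ 2 / 2)))
  simp only [sq_abs, Even.pow_abs (even_two_mul m)] at this
  have hm : (0 : ℝ) ≤ m := m.cast_nonneg
  rw [this, ← integral_rpow_mul_gaussian (by linarith)]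
  congr 1
  refine setIntegral_congr_fun measurableSet_Ioi fun t ht => ?_
  rw [← Real.rpow_natCast]
  push_cast
  rfl

theorem integral_pow_mul_gaussian_odd (m : ℕ) :
    ∫ t : ℝ, t ^ (2 * m + 1) * Real.exp (-(t ^ 2 / 2)) = 0 := by
  have h := integral_neg_eq_self (fun t : ℝ => t ^ (2 * m + 1) * Real.exp (-(t ^ 2 / 2))) volume
  simp only [neg_sq, Odd.neg_pow (odd_two_mul_add_one m), neg_mul] at h
  rw [integral_neg] at h
  linarith

instance isProbabilityMeasure_uniformSphere {d : ℕ} [NeZero d] :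
    IsProbabilityMeasure (uniformSphere d) := by
  refine ⟨?_⟩
  have : Nonempty (Fin d) := ⟨0⟩
  rw [uniformSphere, Measure.smul_apply, smul_eq_mul]
  refine ENNReal.inv_mul_cancel ?_ (measure_ne_top _ _)
  rw [Measure.measure_univ_ne_zero, surfaceMeasure]
  exact Measure.toSphere_ne_zero _

/-- Equating the polar and Cartesian evaluations for `p` and for 0 eliminates the surface area and
the transverse Gaussian factors. -/
theorem integral_uniformSphere_inner_pow_mul {d : ℕ} (hd : 1 ≤ d)
    {u : EuclideanSpace ℝ (Fin d)} (hu : ‖u‖ = 1) (p : ℕ) :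
    (∫ ω, ⟪u, (ω : EuclideanSpace ℝ (Fin d))⟫ ^ p ∂uniformSphere d) *
        (∫ r in Ioi (0 : ℝ), r ^ ((d : ℝ) - 1 + p) * Real.exp (-(r ^ 2 / 2))) *
        (∫ t : ℝ, Real.exp (-(t ^ 2 / 2))) =
      (∫ t : ℝ, t ^ p * Real.exp (-(t ^ 2 / 2))) *
        ∫ r in Ioi (0 : ℝ), r ^ ((d : ℝ) - 1) * Real.exp (-(r ^ 2 / 2)) := by
  have : Nonempty (Fin d) := ⟨⟨0, hd⟩⟩
  have a1 := integral_inner_pow_mul_gaussian_polar hd u p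
  have a0 := integral_inner_pow_mul_gaussian_polar hd u 0
  rw [integral_inner_pow_mul_gaussian hd hu] at a1 a0
  simp only [pow_zero, one_mul, Nat.cast_zero, add_zero, integral_const, smul_eq_mul, mul_one] at a0
  set S := (surfaceMeasure d).real univ
  have hS : S ≠ 0 := by
    rw [Ne, measureReal_eq_zero_iff, Measure.measure_univ_eq_zero, surfaceMeasure]
    exact Measure.toSphere_ne_zero _
  have hG : (∫ t : ℝ, Real.exp (-(t ^ 2 / 2))) ≠ 0 := by
    have := integral_pow_mul_gaussian_even 0
    simp only [mul_zero, pow_zero, one_mul] at this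
    rw [this]
    have := Real.Gamma_pos_of_pos (show (0 : ℝ) < (2 * ((0 : ℕ) : ℝ) + 1) / 2 by norm_num)
    positivity
  rw [uniformSphere, integral_smul_measure, ENNReal.toReal_inv, smul_eq_mul]
  change S⁻¹ * _ * _ * _ = _
  have hp := pow_ne_zero (d - 1) hG
  have : (∫ t : ℝ, Real.exp (-(t ^ 2 / 2))) ^ (d - 1) *
    ((S⁻¹ * ∫ ω, ⟪u, (ω : EuclideanSpace ℝ (Fin d))⟫ ^ p ∂surfaceMeasure d) *
        (∫ r in Ioi (0 : ℝ), r ^ ((d : ℝ) - 1 + p) * Real.exp (-(r ^ 2 / 2))) *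
        (∫ t : ℝ, Real.exp (-(t ^ 2 / 2)))) = (∫ t : ℝ, Real.exp (-(t ^ 2 / 2))) ^ (d - 1) *
      ((∫ t : ℝ, t ^ p * Real.exp (-(t ^ 2 / 2))) *
        ∫ r in Ioi (0 : ℝ), r ^ ((d : ℝ) - 1) * Real.exp (-(r ^ 2 / 2))) := by
    rw [mul_assoc S⁻¹, ← a1]
    field_simp
    linear_combination (∫ t : ℝ, t ^ p * Real.exp (-(t ^ 2 / 2))) * a0
  exact mul_left_cancel₀ hp this

end

section
open scoped RealInnerProductSpace

theorem integral_uniformSphere_inner_pow_odd {d : ℕ} (hd : 1 ≤ d)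
    {u : EuclideanSpace ℝ (Fin d)} (hu : ‖u‖ = 1) (m : ℕ) :
    ∫ ω, ⟪u, (ω : EuclideanSpace ℝ (Fin d))⟫ ^ (2 * m + 1) ∂uniformSphere d = 0 := by
  have h := integral_uniformSphere_inner_pow_mul hd hu (2 * m + 1)
  rw [integral_pow_mul_gaussian_odd, zero_mul] at h
  have hG := integral_pow_mul_gaussian_even 0
  simp only [mul_zero, pow_zero, one_mul] at hG
  have hd' : (1 : ℝ) ≤ d := by exact_mod_cast hd
  rw [hG, integral_rpow_mul_gaussian (by push_cast; linarith [(m.cast_nonneg : (0:ℝ) ≤ m)])] at h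
  have h1 := Real.Gamma_pos_of_pos (show (0 : ℝ) < (2 * ((0 : ℕ) : ℝ) + 1) / 2 by norm_num)
  have h2 := Real.Gamma_pos_of_pos
    (show (0 : ℝ) < ((d : ℝ) - 1 + ((2 * m + 1 : ℕ) : ℝ) + 1) / 2 by push_cast; linarith [(m.cast_nonneg : (0:ℝ) ≤ m)])
  rcases mul_eq_zero.1 h with h | h
  · rcases mul_eq_zero.1 h with h | h
    · exact h
    · exact absurd h (by positivity)
  · exact absurd h (by positivity)

theorem integral_uniformSphere_inner_pow_even {d : ℕ} (hd : 2 ≤ d)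
    {u : EuclideanSpace ℝ (Fin d)} (hu : ‖u‖ = 1) (m : ℕ) :
    ∫ ω, ⟪u, (ω : EuclideanSpace ℝ (Fin d))⟫ ^ (2 * m) ∂uniformSphere d =
      besselCoeff (nuOf d) m * ((2 * m).factorial / 4 ^ m) := by
  have h := integral_uniformSphere_inner_pow_mul (one_le_two.trans hd) hu (2 * m)
  have hd' : (2 : ℝ) ≤ d := by exact_mod_cast hd
  have hm : (0 : ℝ) ≤ m := m.cast_nonneg
  have hG := integral_pow_mul_gaussian_even 0
  simp only [mul_zero, pow_zero, one_mul] at hG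
  rw [hG, integral_pow_mul_gaussian_even, integral_rpow_mul_gaussian (by push_cast; linarith),
    integral_rpow_mul_gaussian (by linarith)] at h
  have hν : nuOf d + 1 = d / 2 := by unfold nuOf; ring
  have h1 := Real.Gamma_pos_of_pos (show (0 : ℝ) < d / 2 by positivity)
  have h2 := Real.Gamma_pos_of_pos (show (0 : ℝ) < m + d / 2 by positivity)
  have e1 : ((d : ℝ) - 1 + ((2 * m : ℕ) : ℝ) + 1) / 2 = m + d / 2 := by push_cast; ring
  have e2 : ((d : ℝ) - 1 + 1) / 2 = d / 2 := by ring
  have e3 : ((d : ℝ) - 1 + ((2 * m : ℕ) : ℝ) - 1) / 2 = ((d : ℝ) - 1 - 1) / 2 + m := by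
    push_cast; ring
  have e4 : (2 * (m : ℝ) - 1) / 2 = (2 * ((0 : ℕ) : ℝ) - 1) / 2 + m := by push_cast; ring
  have e5 : (2 * ((0 : ℕ) : ℝ) + 1) / 2 = 1 / 2 := by norm_num
  have e6 : (2 * (m : ℝ) + 1) / 2 = m + 1 / 2 := by ring
  -- Half-integer values of Γ, by induction. They produce the `(2 * m)!` that later cancels against
  -- the exponential series.
  have e7 : Real.Gamma (m + 1 / 2) * (4 ^ m * m.factorial) =
      (2 * m).factorial * Real.Gamma (1 / 2) := by
    clear h e1 e3 e4 e6 h2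
    induction m with
    | zero => simp
    | succ m ih =>
      have ih' := ih m.cast_nonneg
      rw [show ((m + 1 : ℕ) : ℝ) + 1 / 2 = (m + 1 / 2) + 1 by push_cast; ring,
        Real.Gamma_add_one (s := (m : ℝ) + 1 / 2) (by positivity), show 2 * (m + 1) = 2 * m + 1 + 1 by ring,
        Nat.factorial_succ, Nat.factorial_succ, Nat.factorial_succ]
      push_cast
      linear_combination (2 * (m : ℝ) + 1 + 1) * (2 * (m : ℝ) + 1) * ih'
  rw [e1, e2, e3, e4, e5, e6, Real.rpow_add two_pos, Real.rpow_add two_pos, Real.rpow_natCast] at h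
  have h3 : Real.Gamma ((1 : ℝ) / 2) ≠ 0 := (Real.Gamma_pos_of_pos (by norm_num)).ne'
  unfold besselCoeff
  rw [add_assoc (m : ℝ), hν]
  have hA : (0 : ℝ) < 2 ^ (((d : ℝ) - 1 - 1) / 2) := by positivity
  have hB : (0 : ℝ) < 2 ^ ((2 * ((0 : ℕ) : ℝ) - 1) / 2) := by positivity
  have hC : (0 : ℝ) < 2 ^ m := by positivity
  generalize (2 : ℝ) ^ (((d : ℝ) - 1 - 1) / 2) = A at *
  generalize (2 : ℝ) ^ ((2 * ((0 : ℕ) : ℝ) - 1) / 2) = B at *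
  generalize (∫ ω, ⟪u, (ω : EuclideanSpace ℝ (Fin d))⟫ ^ (2 * m) ∂uniformSphere d) = X at *
  have h' : X * Real.Gamma (m + d / 2) * Real.Gamma (1 / 2) =
      Real.Gamma (m + 1 / 2) * Real.Gamma (d / 2) := by
    have h0 : A * B * 2 ^ m * 2 ≠ 0 := by positivity
    apply mul_left_cancel₀ h0
    linear_combination h
  rw [div_mul_div_comm, eq_div_iff (by positivity)]
  have : (X * (m.factorial * Real.Gamma (m + d / 2) * 4 ^ m)) * Real.Gamma (1 / 2) =
      (Real.Gamma (d / 2) * (2 * m).factorial) * Real.Gamma (1 / 2) := by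
    linear_combination (m.factorial * 4 ^ m : ℝ) * h' + Real.Gamma (d / 2) * e7
  exact mul_right_cancel₀ h3 this

/-- The Fourier transform of the uniform distribution on the sphere. -/
theorem integral_uniformSphere_exp_inner {d : ℕ} (hd : 2 ≤ d) (y : EuclideanSpace ℝ (Fin d)) :
    ∫ ω, Complex.exp ((⟪y, (ω : EuclideanSpace ℝ (Fin d))⟫ : ℝ) * Complex.I) ∂uniformSphere d =
      (besselj (nuOf d) ‖y‖ : ℂ) := by
  have : NeZero d := ⟨by omega⟩
  obtain ⟨u, hu, hy⟩ : ∃ u : EuclideanSpace ℝ (Fin d), ‖u‖ = 1 ∧ y = ‖y‖ • u := by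
    by_cases h0 : y = 0
    · exact ⟨EuclideanSpace.single 0 1, by simp, by simp [h0]⟩
    · have h1 := norm_ne_zero_iff.2 h0
      refine ⟨‖y‖⁻¹ • y, by rw [norm_smul, norm_inv, norm_norm, inv_mul_cancel₀ h1], ?_⟩
      rw [smul_smul, mul_inv_cancel₀ h1, one_smul]
  set t := ‖y‖ with ht
  have ht0 : 0 ≤ t := norm_nonneg y
  rw [hy]
  simp only [inner_smul_left, RCLike.conj_to_real]
  set f : UnitSphere d → ℝ := fun ω => ⟪u, (ω : EuclideanSpace ℝ (Fin d))⟫ with hf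
  have hfc : Continuous f := by fun_prop
  have hf1 : ∀ ω, |f ω| ≤ 1 := fun ω => by
    have := abs_real_inner_le_norm u (ω : EuclideanSpace ℝ (Fin d))
    rwa [hu, norm_eq_of_mem_sphere ω, one_mul] at this
  set F : ℕ → UnitSphere d → ℂ := fun p ω => (t * Complex.I) ^ p / p.factorial * ((f ω ^ p : ℝ) : ℂ)
  have hFc : ∀ p, Continuous (F p) := fun p => by fun_prop
  have hFb : ∀ p ω, ‖F p ω‖ ≤ t ^ p / p.factorial := fun p ω => by
    simp only [F]
    rw [norm_mul, norm_div, norm_pow, norm_mul, Complex.norm_I, mul_one, Complex.norm_real,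
      Complex.norm_real, Complex.norm_natCast, Real.norm_of_nonneg ht0, norm_pow, Real.norm_eq_abs]
    exact mul_le_of_le_one_right (by positivity) (pow_le_one₀ (abs_nonneg _) (hf1 ω))
  have hFi : ∀ p, Integrable (F p) (uniformSphere d) := fun p =>
    Integrable.of_bound (hFc p).aestronglyMeasurable _ (Filter.Eventually.of_forall (hFb p))
  have hsum := hasSum_integral_of_summable_integral_norm hFi (by
    refine Summable.of_nonneg_of_le (fun p => integral_nonneg fun ω => norm_nonneg _) (fun p => ?_)
      (Real.summable_pow_div_factorial t)
    calc ∫ ω, ‖F p ω‖ ∂uniformSphere d ≤ ∫ ω, t ^ p / p.factorial ∂uniformSphere d :=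
          integral_mono (hFi p).norm (integrable_const _) (hFb p)
      _ = _ := by simp)
  have e1 : ∀ ω, ∑' p, F p ω = Complex.exp (((t * f ω : ℝ) : ℂ) * Complex.I) := fun ω => by
    rw [Complex.exp_eq_exp_ℂ, NormedSpace.exp_eq_tsum_div]
    refine tsum_congr fun p => ?_
    simp only [F]
    push_cast
    rw [mul_right_comm (t : ℂ), mul_pow _ (f ω : ℂ)]
    ring
  simp only [e1] at hsum
  have e2 : ∀ p, ∫ ω, F p ω ∂uniformSphere d =
      (t * Complex.I) ^ p / p.factorial * ((∫ ω, f ω ^ p ∂uniformSphere d : ℝ) : ℂ) := fun p => by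
    simp only [F]
    rw [integral_const_mul, integral_complex_ofReal]
  simp only [e2] at hsum
  -- Odd moments vanish, so the exponential series may be summed over even exponents only, which
  -- gives the Bessel series.
  have hinj : Function.Injective fun m : ℕ => 2 * m := fun a b h => by simpa using h
  rw [← hinj.hasSum_iff] at hsum
  · rw [← hsum.tsum_eq, besselj_eq_series, besselSeries, Complex.ofReal_tsum]
    refine tsum_congr fun m => ?_
    simp only [Function.comp, hf]
    rw [integral_uniformSphere_inner_pow_even hd hu, pow_mul, mul_pow, Complex.I_sq]
    have h4 : ((2 * m).factorial : ℂ) ≠ 0 := by exact_mod_cast Nat.factorial_ne_zero _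
    push_cast
    field_simp
    rw [show -(t : ℂ) ^ 2 = 4 * -((t : ℂ) ^ 2 / 4) by ring, mul_pow]
    ring
  · intro p hp
    obtain ⟨m, rfl⟩ : ∃ m, p = 2 * m + 1 := by
      rcases Nat.even_or_odd' p with ⟨m, h | h⟩
      · exact absurd ⟨m, h.symm⟩ hp
      · exact ⟨m, h⟩
    rw [integral_uniformSphere_inner_pow_odd (one_le_two.trans hd) hu]
    simp

end

/-! ### Absolute continuity of the law of the distance. -/

section
open scoped RealInnerProductSpace

/-- A set that meets almost every line in a given direction in a null set is a null set. -/
theorem volume_eq_zero_of_lines {E : Type*} [NormedAddCommGroup E] [InnerProductSpace ℝ E]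
    [FiniteDimensional ℝ E] [MeasurableSpace E] [BorelSpace E] {A : Set E} (hA : MeasurableSet A)
    (u : E) (h : ∀ᵐ x : E, volume {t : ℝ | x + t • u ∈ A} = 0) : volume A = 0 := by
  set S : Set (E × ℝ) := {z | z.1 + z.2 • u ∈ A} with hS
  have hSm : MeasurableSet S := by
    have : Measurable fun z : E × ℝ => z.1 + z.2 • u := by fun_prop
    exact this hA
  have h0 : (volume.prod volume : Measure (E × ℝ)) S = 0 := by
    rw [Measure.measure_prod_null hSm]
    exact h
  rw [Measure.prod_apply_symm hSm] at h0
  have h1 : ∀ t : ℝ, volume ((fun x : E => (x, t)) ⁻¹' S) = volume A := fun t => by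
    have : (fun x : E => (x, t)) ⁻¹' S = (fun x => x + t • u) ⁻¹' A := rfl
    rw [this, measure_preimage_add_right]
  simp only [h1, lintegral_const, Real.volume_univ] at h0
  simpa using h0

/-- The map `t ↦ q = (a + t) / √(c² + (a + t)²)` has inverse `q ↦ c q / √(1 - q²) - a`,
differentiable on (-1, 1). The set is thus contained in a differentiable image of a null set. -/
theorem volume_line_angle_null {c : ℝ} (hc : 0 < c) (a : ℝ) {N : Set ℝ} (hN : volume N = 0) :
    volume {t : ℝ | (a + t) / √(c ^ 2 + (a + t) ^ 2) ∈ N} = 0 := by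
  have hd : DifferentiableOn ℝ (fun q : ℝ => c * q / √(1 - q ^ 2) - a) (N ∩ Ioo (-1) 1) := by
    intro q hq
    have h1 : 0 < 1 - q ^ 2 := by nlinarith [hq.2.1, hq.2.2]
    have : √(1 - q ^ 2) ≠ 0 := (Real.sqrt_pos.2 h1).ne'
    have h2 : DifferentiableAt ℝ (fun q : ℝ => √(1 - q ^ 2)) q :=
      DifferentiableAt.sqrt (by fun_prop) h1.ne'
    exact (((differentiableAt_id.const_mul c).div h2 this).sub_const a).differentiableWithinAt
  have h0 := addHaar_image_eq_zero_of_differentiableOn_of_addHaar_eq_zero (μ := volume) hd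
    (measure_mono_null inter_subset_left hN)
  refine measure_mono_null (fun t ht => ?_) h0
  have hr : 0 < c ^ 2 + (a + t) ^ 2 := by positivity
  set R := √(c ^ 2 + (a + t) ^ 2) with hR
  have hR0 : 0 < R := Real.sqrt_pos.2 hr
  have hR2 : R ^ 2 = c ^ 2 + (a + t) ^ 2 := Real.sq_sqrt hr.le
  have hq : 1 - ((a + t) / R) ^ 2 = (c / R) ^ 2 := by
    field_simp; linarith
  refine ⟨(a + t) / R, ⟨ht, ?_⟩, ?_⟩
  · have : ((a + t) / R) ^ 2 < 1 := by
      have : 0 < (c / R) ^ 2 := by positivity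
      linarith
    exact abs_lt.1 ((sq_lt_one_iff_abs_lt_one _).1 this)
  · simp only
    rw [hq, Real.sqrt_sq (by positivity)]
    field_simp
    ring

/-- The law of a coordinate of a uniform point of the sphere has no singular part. -/
theorem uniformSphere_inner_null {d : ℕ} (hd : 2 ≤ d) {u : EuclideanSpace ℝ (Fin d)}
    (hu : ‖u‖ = 1) {N : Set ℝ} (hN : volume N = 0) :
    uniformSphere d {ω | ⟪u, (ω : EuclideanSpace ℝ (Fin d))⟫ ∈ N} = 0 := by
  set N' := toMeasurable volume N
  have hN' : volume N' = 0 := by rw [measure_toMeasurable, hN]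
  have hNm : MeasurableSet N' := measurableSet_toMeasurable _ _
  refine measure_mono_null (t := {ω | ⟪u, (ω : EuclideanSpace ℝ (Fin d))⟫ ∈ N'})
    (fun ω hω => subset_toMeasurable _ _ hω) ?_
  -- The quotient is invariant under positive scaling, so `A` contains the cone over the set in
  -- question. Surface measure is a multiple of the volume of that cone inside the unit ball.
  set A : Set (EuclideanSpace ℝ (Fin d)) := {x | ⟪u, x⟫ / ‖x‖ ∈ N'}
  have hA : MeasurableSet A := by
    have : Measurable fun x : EuclideanSpace ℝ (Fin d) => ⟪u, x⟫ / ‖x‖ := by fun_prop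
    exact this hNm
  have hA0 : volume A = 0 := by
    refine volume_eq_zero_of_lines hA u ?_
    -- Since `d ≥ 2`, the line ℝu is null; a parallel line off it stays at positive distance from
    -- the origin.
    have hspan : (ℝ ∙ u) ≠ ⊤ := by
      intro h
      have h1 := finrank_span_le_card (R := ℝ) ({u} : Set (EuclideanSpace ℝ (Fin d)))
      rw [h, finrank_top] at h1
      simp at h1
      omega
    have hae : ∀ᵐ x : EuclideanSpace ℝ (Fin d), x ∉ (ℝ ∙ u) := by
      rw [ae_iff]
      simpa using Measure.addHaar_submodule volume _ hspan
    filter_upwards [hae] with x hx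
    set a := ⟪u, x⟫ with ha
    have hne : x - a • u ≠ 0 := fun h0 =>
      hx (Submodule.mem_span_singleton.2 ⟨a, (sub_eq_zero.1 h0).symm⟩)
    have h1 := volume_line_angle_null (norm_pos_iff.2 hne) a hN'
    refine measure_mono_null (fun t ht => ?_) h1
    have huu : ⟪u, u⟫ = 1 := by rw [real_inner_self_eq_norm_sq, hu]; norm_num
    have e1 : ⟪u, x + t • u⟫ = a + t := by
      rw [inner_add_right, inner_smul_right, huu]; ring
    have e2 : ‖x + t • u‖ ^ 2 = ‖x - a • u‖ ^ 2 + (a + t) ^ 2 := by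
      rw [norm_add_sq_real, norm_sub_sq_real, inner_smul_right, inner_smul_right, norm_smul,
        norm_smul, hu, real_inner_comm, ← ha]
      simp only [mul_one, Real.norm_eq_abs, sq_abs]
      ring
    have ht' : ⟪u, x + t • u⟫ / ‖x + t • u‖ ∈ N' := ht
    rw [e1, ← Real.sqrt_sq (norm_nonneg (x + t • u)), e2] at ht'
    exact ht'
  have hm : MeasurableSet {ω : UnitSphere d | ⟪u, (ω : EuclideanSpace ℝ (Fin d))⟫ ∈ N'} := by
    have : Measurable fun ω : UnitSphere d => ⟪u, (ω : EuclideanSpace ℝ (Fin d))⟫ := by fun_prop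
    exact this hNm
  rw [uniformSphere, Measure.smul_apply, surfaceMeasure, Measure.toSphere_apply' _ hm,
    measure_mono_null ?_ hA0]
  · simp
  · rintro _ ⟨r, hr, _, ⟨ω, hω, rfl⟩, rfl⟩
    change ⟪u, r • (ω : EuclideanSpace ℝ (Fin d))⟫ / ‖r • (ω : EuclideanSpace ℝ (Fin d))‖ ∈ N'
    rw [inner_smul_right, norm_smul, norm_eq_of_mem_sphere, Real.norm_of_nonneg hr.1.le, mul_one,
      mul_div_cancel_left₀ _ hr.1.ne']
    exact hω

/-- ‖ω + v‖² = 1 + ‖v‖² + 2⟨ω, v⟩, so the norm determines the coordinate of ω along v by a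
polynomial, and polynomials preserve null sets. -/
theorem uniformSphere_norm_add_null {d : ℕ} (hd : 2 ≤ d) {v : EuclideanSpace ℝ (Fin d)}
    (hv : v ≠ 0) {N : Set ℝ} (hN : volume N = 0) :
    uniformSphere d {ω | ‖(ω : EuclideanSpace ℝ (Fin d)) + v‖ ∈ N} = 0 := by
  have hv0 : 0 < ‖v‖ := norm_pos_iff.2 hv
  have h0 := addHaar_image_eq_zero_of_differentiableOn_of_addHaar_eq_zero (μ := volume) (s := N)
    (f := fun y : ℝ => (y ^ 2 - 1 - ‖v‖ ^ 2) / (2 * ‖v‖)) (by fun_prop) hN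
  have h1 := uniformSphere_inner_null hd (u := ‖v‖⁻¹ • v)
    (by rw [norm_smul, norm_inv, norm_norm, inv_mul_cancel₀ hv0.ne']) h0
  refine measure_mono_null (fun ω hω => ?_) h1
  refine (mem_image _ _ _).2 ⟨_, hω, ?_⟩
  rw [norm_add_sq_real, norm_eq_of_mem_sphere, inner_smul_left, real_inner_comm]
  simp only [RCLike.conj_to_real]
  field_simp
  ring

theorem uniformSphere_singleton_null {d : ℕ} (hd : 2 ≤ d) (w : EuclideanSpace ℝ (Fin d)) :
    uniformSphere d {ω | (ω : EuclideanSpace ℝ (Fin d)) = w} = 0 := by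
  have : NeZero d := ⟨by omega⟩
  have h1 := uniformSphere_inner_null hd (u := EuclideanSpace.single 0 1) (by simp)
    (N := {⟪EuclideanSpace.single 0 1, w⟫}) (by simp)
  refine measure_mono_null (fun ω hω => ?_) h1
  rw [← (show (ω : EuclideanSpace ℝ (Fin d)) = w from hω)]
  rfl

/-- Fubini, with the first step split off from the rest. -/
theorem walkMeasure_succ_null {m d : ℕ} {T : Set (UnitSphere d × (Fin m → UnitSphere d))}
    (hT : MeasurableSet T)
    (h : ∀ᵐ τ ∂walkMeasure m d, uniformSphere d {ω | (ω, τ) ∈ T} = 0) :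
    walkMeasure (m + 1) d {ω | (ω 0, fun i => ω (Fin.succ i)) ∈ T} = 0 := by
  have hp := measurePreserving_piFinSuccAbove (fun _ : Fin (m + 1) => uniformSphere d) 0
  have h0 : ((uniformSphere d).prod (walkMeasure m d)) T = 0 := by
    unfold walkMeasure at h ⊢
    rw [Measure.prod_apply_symm hT, lintegral_eq_zero_iff (measurable_measure_prodMk_right hT)]
    exact h
  have := hp.measure_preimage hT.nullMeasurableSet
  rw [show Measure.pi (fun j => (fun _ : Fin (m + 1) => uniformSphere d) (Fin.succAbove 0 j)) =
    walkMeasure m d from rfl, h0] at this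
  exact this

theorem ae_walk_ne_zero {m d : ℕ} (hd : 2 ≤ d) :
    ∀ᵐ ω ∂walkMeasure (m + 1) d, ∑ i, (ω i : EuclideanSpace ℝ (Fin d)) ≠ 0 := by
  rw [ae_iff]
  have hm : MeasurableSet {z : UnitSphere d × (Fin m → UnitSphere d) |
      (z.1 : EuclideanSpace ℝ (Fin d)) + ∑ i, (z.2 i : EuclideanSpace ℝ (Fin d)) = 0} :=
    measurableSet_eq_fun (by fun_prop) (by fun_prop)
  refine measure_mono_null (fun ω hω => ?_) (walkMeasure_succ_null hm
    (Filter.Eventually.of_forall fun τ => ?_))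
  · simpa [Fin.sum_univ_succ] using hω
  · refine measure_mono_null (fun ω hω => ?_)
      (uniformSphere_singleton_null hd (-∑ i, (τ i : EuclideanSpace ℝ (Fin d))))
    exact eq_neg_of_add_eq_zero_left hω

theorem measurable_walkDist (n d : ℕ) : Measurable (walkDist n d) := by
  unfold walkDist
  fun_prop

/-- Condition on all steps but the first. As `n ≥ 2`, their sum is almost surely nonzero, and the
first step alone spreads the norm absolutely continuously; a single step would have constant norm.
-/
theorem walkDist_null {n d : ℕ} (hn : 2 ≤ n) (hd : 2 ≤ d) {N : Set ℝ} (hN : volume N = 0) :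
    walkMeasure n d {ω | walkDist n d ω ∈ N} = 0 := by
  obtain ⟨m, rfl⟩ : ∃ m, n = m + 1 + 1 := ⟨n - 2, by omega⟩
  set N' := toMeasurable volume N
  have hN' : volume N' = 0 := by rw [measure_toMeasurable, hN]
  have hT : MeasurableSet {z : UnitSphere d × (Fin (m + 1) → UnitSphere d) |
      ‖(z.1 : EuclideanSpace ℝ (Fin d)) + ∑ i, (z.2 i : EuclideanSpace ℝ (Fin d))‖ ∈ N'} := by
    have : Measurable fun z : UnitSphere d × (Fin (m + 1) → UnitSphere d) =>
      ‖(z.1 : EuclideanSpace ℝ (Fin d)) + ∑ i, (z.2 i : EuclideanSpace ℝ (Fin d))‖ := by fun_prop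
    exact this (measurableSet_toMeasurable _ _)
  refine measure_mono_null (fun ω hω => ?_) (walkMeasure_succ_null hT ?_)
  · have := subset_toMeasurable volume N hω
    simp only [walkDist, Fin.sum_univ_succ] at this
    simpa [Fin.sum_univ_succ] using this
  · filter_upwards [ae_walk_ne_zero hd] with τ hτ
    exact uniformSphere_norm_add_null hd hτ hN'

theorem hasPDF_walkDist {n d : ℕ} (hn : 2 ≤ n) (hd : 2 ≤ d) :
    HasPDF (walkDist n d) (walkMeasure n d) volume := by
  have : NeZero d := ⟨by omega⟩
  have hm := measurable_walkDist n d
  have : IsFiniteMeasure (walkMeasure n d) := by unfold walkMeasure; infer_instance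
  rw [Real.hasPDF_iff_of_aemeasurable hm.aemeasurable]
  refine Measure.AbsolutelyContinuous.mk fun N hNm hN => ?_
  rw [Measure.map_apply hm hNm]
  exact walkDist_null hn hd hN

theorem ae_walkDist_pos {n d : ℕ} (hn : 2 ≤ n) (hd : 2 ≤ d) :
    ∀ᵐ ω ∂walkMeasure n d, 0 < walkDist n d ω := by
  have h := walkDist_null hn hd (N := {0}) (by simp)
  have h' : ∀ᵐ ω ∂walkMeasure n d, walkDist n d ω ∉ ({0} : Set ℝ) := by
    rw [ae_iff]; simpa using h
  filter_upwards [h'] with ω hω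
  exact lt_of_le_of_ne (norm_nonneg _) (Ne.symm hω)

end

/-! ### Bessel expectations along the walk. -/

section
open scoped RealInnerProductSpace

theorem besselj_abs (μ x : ℝ) : besselj μ |x| = besselj μ x := by
  rw [besselj_eq_series, besselj_eq_series, sq_abs]

theorem besselj_bounded {μ : ℝ} (hμ : 0 ≤ μ) : ∃ C, 0 ≤ C ∧ ∀ x, |besselj μ x| ≤ C := by
  obtain ⟨C, hC, h⟩ := besselj_decay hμ
  refine ⟨C, hC, fun x => ?_⟩
  rw [← besselj_abs]
  refine (h |x| (abs_nonneg x)).trans (mul_le_of_le_one_right hC ?_)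
  exact Real.rpow_le_one_of_one_le_of_nonpos (by linarith [abs_nonneg x]) (by linarith)

theorem nuOf_nonneg {d : ℕ} (hd : 2 ≤ d) : 0 ≤ nuOf d := by
  have : (2 : ℝ) ≤ d := by exact_mod_cast hd
  unfold nuOf
  linarith

instance isProbabilityMeasure_walkMeasure {n d : ℕ} [NeZero d] :
    IsProbabilityMeasure (walkMeasure n d) := by
  unfold walkMeasure; infer_instance

theorem continuous_walkDist (n d : ℕ) : Continuous (walkDist n d) := by
  unfold walkDist
  fun_prop

theorem walkDist_nonneg {n d : ℕ} (ω : Fin n → UnitSphere d) : 0 ≤ walkDist n d ω := norm_nonneg _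

theorem walkDist_le {n d : ℕ} (ω : Fin n → UnitSphere d) : walkDist n d ω ≤ n := by
  refine (norm_sum_le _ _).trans ?_
  simp

/-- The expectation of `j_ν(x |X|)` for the `n`-step walk `X` is `j_ν(x) ^ n`. -/
theorem integral_besselj_walkDist {n d : ℕ} (hd : 2 ≤ d) (x : ℝ) :
    ∫ ω, besselj (nuOf d) (x * walkDist n d ω) ∂walkMeasure n d = besselj (nuOf d) x ^ n := by
  have : NeZero d := ⟨by omega⟩
  -- An auxiliary uniform direction η is added. Integrating the walk first factorises into `j_ν(x) ^
  -- n` whatever η is; integrating η first gives `j_ν(x |X|)`.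
  set φ : UnitSphere d → (Fin n → UnitSphere d) → ℂ := fun η ω =>
    Complex.exp ((⟪x • ∑ i, (ω i : EuclideanSpace ℝ (Fin d)),
      (η : EuclideanSpace ℝ (Fin d))⟫ : ℝ) * Complex.I)
  have hc : Continuous (Function.uncurry φ) := by
    simp only [φ, Function.uncurry_def]
    fun_prop
  have hi : Integrable (Function.uncurry φ) ((uniformSphere d).prod (walkMeasure n d)) := by
    refine Integrable.of_bound hc.aestronglyMeasurable 1 (Filter.Eventually.of_forall fun z => ?_)
    simp only [φ, Function.uncurry_def, Complex.norm_exp_ofReal_mul_I, le_refl]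
  have h1 : ∀ η, ∫ ω, φ η ω ∂walkMeasure n d = (besselj (nuOf d) x : ℂ) ^ n := fun η => by
    have e := integral_fintype_prod_eq_pow (ι := Fin n) (μ := uniformSphere d)
      (fun ω : UnitSphere d => Complex.exp ((⟪x • (η : EuclideanSpace ℝ (Fin d)),
        (ω : EuclideanSpace ℝ (Fin d))⟫ : ℝ) * Complex.I))
    rw [integral_uniformSphere_exp_inner hd, norm_smul, norm_eq_of_mem_sphere, mul_one,
      Real.norm_eq_abs, besselj_abs, Fintype.card_fin] at e
    rw [← e, walkMeasure]
    refine integral_congr_ae (Filter.Eventually.of_forall fun ω => ?_)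
    simp only [φ]
    rw [← Complex.exp_sum, ← Finset.sum_mul, ← Complex.ofReal_sum, ← inner_sum,
      inner_smul_left, inner_smul_left, real_inner_comm]
  have h2 : ∀ ω, ∫ η, φ η ω ∂uniformSphere d =
      ((besselj (nuOf d) (x * walkDist n d ω) : ℝ) : ℂ) := fun ω => by
    simp only [φ]
    rw [integral_uniformSphere_exp_inner hd, norm_smul, Real.norm_eq_abs, ← besselj_abs _ (x * _),
      abs_mul, abs_of_nonneg (walkDist_nonneg ω)]
    rfl
  have h3 := integral_integral_swap hi
  simp only [h1, h2] at h3
  rw [integral_const, probReal_univ, one_smul, integral_complex_ofReal] at h3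
  exact_mod_cast h3.symm

/-- The expectation of `|X| ^ (2 k) j_μ(x |X|)`. -/
noncomputable def besselMean (n d k : ℕ) (μ x : ℝ) : ℝ :=
  ∫ ω, walkDist n d ω ^ (2 * k) * besselj μ (x * walkDist n d ω) ∂walkMeasure n d

theorem abs_walkDist_pow_le {n d : ℕ} (k : ℕ) (ω : Fin n → UnitSphere d) :
    |walkDist n d ω ^ k| ≤ (n : ℝ) ^ k := by
  rw [abs_pow, abs_of_nonneg (walkDist_nonneg ω)]
  exact pow_le_pow_left₀ (walkDist_nonneg ω) (walkDist_le ω) k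

/-- The chain rule brings out `|X| ^ 2` and raises the index. Since `|X| ≤ n` and j_{μ+1} is
bounded, domination under the integral is immediate. -/
theorem hasDerivAt_besselMean {n d : ℕ} [NeZero d] (k : ℕ) {μ : ℝ} (hμ : 0 ≤ μ) (x : ℝ) :
    HasDerivAt (besselMean n d k μ) (-(x / (2 * (μ + 1))) * besselMean n d (k + 1) (μ + 1) x) x := by
  obtain ⟨C, hC, hb⟩ := besselj_bounded (μ := μ + 1) (by positivity)
  have hμc := continuous_besselj hμ
  have hμc' := continuous_besselj (μ := μ + 1) (by positivity)
  have hr := continuous_walkDist n d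
  obtain ⟨C₀, hC₀, hb₀⟩ := besselj_bounded hμ
  set F' : ℝ → (Fin n → UnitSphere d) → ℝ := fun y ω => -(y / (2 * (μ + 1))) *
    (walkDist n d ω ^ (2 * (k + 1)) * besselj (μ + 1) (y * walkDist n d ω)) with hF'
  have := hasDerivAt_integral_of_dominated_loc_of_deriv_le (μ := walkMeasure n d) (x₀ := x)
    (F := fun y ω => walkDist n d ω ^ (2 * k) * besselj μ (y * walkDist n d ω)) (F' := F')
    (bound := fun _ => (|x| + 1) / (2 * (μ + 1)) * ((n : ℝ) ^ (2 * (k + 1)) * C))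
    (Metric.ball_mem_nhds x one_pos) ?_ ?_ ?_ ?_ (integrable_const _) ?_
  · refine this.2.congr_deriv ?_
    simp only [hF']
    rw [integral_const_mul]
    rfl
  · exact Filter.Eventually.of_forall fun y => Continuous.aestronglyMeasurable (by fun_prop)
  · refine Integrable.of_bound (C := (n : ℝ) ^ (2 * k) * C₀)
      (Continuous.aestronglyMeasurable (by fun_prop)) (Filter.Eventually.of_forall fun ω => ?_)
    rw [norm_mul]
    exact mul_le_mul (abs_walkDist_pow_le _ ω) (hb₀ _) (norm_nonneg _) (by positivity)
  · exact Continuous.aestronglyMeasurable (by fun_prop)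
  · refine Filter.Eventually.of_forall fun ω y hy => ?_
    have hy' : |y| ≤ |x| + 1 := by
      have h1 : |y - x| < 1 := hy
      have h2 := abs_add_le (y - x) x
      rw [sub_add_cancel] at h2
      linarith
    simp only [hF']
    rw [norm_mul, norm_mul, norm_neg, norm_div, Real.norm_eq_abs y,
      Real.norm_of_nonneg (show 0 ≤ 2 * (μ + 1) by positivity)]
    exact mul_le_mul (by gcongr) (mul_le_mul (abs_walkDist_pow_le _ ω) (hb _) (norm_nonneg _)
      (by positivity)) (by positivity) (by positivity)
  · refine Filter.Eventually.of_forall fun ω y _ => ?_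
    have h1 := (hasDerivAt_besselj hμ (y * walkDist n d ω)).comp y
      ((hasDerivAt_id y).mul_const (walkDist n d ω))
    refine (h1.const_mul (walkDist n d ω ^ (2 * k))).congr_deriv ?_
    simp only [hF']
    ring

/-- The constant in `(-(1/x) d/dx)^k j_ν = besselShift ν k • j_{ν+k}`. -/
noncomputable def besselShift (ν : ℝ) (k : ℕ) : ℝ :=
  Real.Gamma (ν + 1) / (2 ^ k * Real.Gamma (ν + k + 1))

theorem besselShift_succ {ν : ℝ} (hν : 0 ≤ ν) (k : ℕ) :
    besselShift ν (k + 1) = besselShift ν k / (2 * (ν + k + 1)) := by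
  have h := Real.Gamma_pos_of_pos (show 0 < ν + k + 1 by positivity)
  unfold besselShift
  rw [show ν + ((k + 1 : ℕ) : ℝ) + 1 = ν + k + 1 + 1 by push_cast; ring,
    Real.Gamma_add_one (s := ν + k + 1) (by positivity), pow_succ]
  field_simp

theorem iterate_besselD_besselj_pow {n d : ℕ} (hd : 2 ≤ d) (k : ℕ) {x : ℝ} (hx : 0 < x) :
    besselD^[k] (fun y => besselj (nuOf d) y ^ n) x =
      besselShift (nuOf d) k * besselMean n d k (nuOf d + k) x := by
  have : NeZero d := ⟨by omega⟩
  have hν := nuOf_nonneg hd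
  induction k generalizing x with
  | zero =>
    have h := Real.Gamma_pos_of_pos (show 0 < nuOf d + 1 by positivity)
    simp [besselShift, besselMean, integral_besselj_walkDist hd, h.ne']
  | succ k ih =>
    rw [Function.iterate_succ_apply', besselD_congr (fun y hy => ih hy) hx, besselD]
    have h1 := (hasDerivAt_besselMean (n := n) (d := d) k (μ := nuOf d + k) (by positivity) x).const_mul
      (besselShift (nuOf d) k)
    rw [h1.deriv, besselShift_succ hν]
    push_cast
    rw [← add_assoc]
    field_simp

/-- The exponent `2 * (ν + k) + 1` is the weight matching the index ν + k, so each j_{ν+k} averages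
to a Gaussian: an oscillating kernel becomes positive. The constant is independent of `k` because
`besselShift` cancels the Hankel constant. -/
theorem integral_gaussian_iterate {n d : ℕ} (hd : 2 ≤ d) (k : ℕ) {x : ℝ} (hx : 0 < x) :
    ∫ ρ in Ioi (0 : ℝ), ρ ^ (2 * (nuOf d + k) + 1) * Real.exp (-(ρ ^ 2 / 2)) *
        besselD^[k] (fun y => besselj (nuOf d) y ^ n) (x * ρ) =
      2 ^ nuOf d * Real.Gamma (nuOf d + 1) *
        ∫ ω, walkDist n d ω ^ (2 * k) * Real.exp (-((x * walkDist n d ω) ^ 2 / 2))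
          ∂walkMeasure n d := by
  have : NeZero d := ⟨by omega⟩
  have hν := nuOf_nonneg hd
  set μ := nuOf d + k with hμd
  have hμ : 0 ≤ μ := by positivity
  obtain ⟨C, hC, hb⟩ := besselj_bounded hμ
  have hμc := continuous_besselj hμ
  have hr := continuous_walkDist n d
  have hg : IntegrableOn (fun ρ : ℝ => ρ ^ (2 * μ + 1) * Real.exp (-(ρ ^ 2 / 2))) (Ioi 0) :=
    integrableOn_rpow_mul_gaussian (by linarith)
  set Φ : ℝ → (Fin n → UnitSphere d) → ℝ := fun ρ ω =>
    ρ ^ (2 * μ + 1) * Real.exp (-(ρ ^ 2 / 2)) *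
      (walkDist n d ω ^ (2 * k) * besselj μ (x * walkDist n d ω * ρ)) with hΦ
  have hi : Integrable (Function.uncurry Φ) ((volume.restrict (Ioi 0)).prod (walkMeasure n d)) := by
    have h1 := hg.mul_prod (integrable_const ((n : ℝ) ^ (2 * k) * C) (μ := walkMeasure n d))
    refine h1.mono ?_ (Filter.Eventually.of_forall fun z => ?_)
    · refine AEStronglyMeasurable.mul ?_ (Continuous.aestronglyMeasurable (by fun_prop))
      exact hg.aestronglyMeasurable.comp_fst
    · simp only [hΦ, Function.uncurry_def, norm_mul]
      gcongr
      · exact (abs_walkDist_pow_le _ _).trans (le_abs_self _)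
      · exact (hb _).trans (le_abs_self _)
  have h1 : ∀ ω, ∫ ρ in Ioi (0 : ℝ), Φ ρ ω = walkDist n d ω ^ (2 * k) *
      (2 ^ μ * Real.Gamma (μ + 1) * Real.exp (-((x * walkDist n d ω) ^ 2 / 2))) := fun ω => by
    rw [← integral_besselj_gaussian hμ, ← integral_const_mul]
    refine integral_congr_ae (Filter.Eventually.of_forall fun ρ => ?_)
    simp only [hΦ]
    ring
  have h2 : ∀ ρ, ∫ ω, Φ ρ ω ∂walkMeasure n d =
      ρ ^ (2 * μ + 1) * Real.exp (-(ρ ^ 2 / 2)) * besselMean n d k μ (x * ρ) := fun ρ => by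
    simp only [hΦ]
    rw [integral_const_mul, besselMean]
    congr 2
    ext ω
    rw [mul_right_comm]
  have h3 := integral_integral_swap hi
  simp only [h1, h2] at h3
  have e1 : ∫ ρ in Ioi (0 : ℝ), ρ ^ (2 * μ + 1) * Real.exp (-(ρ ^ 2 / 2)) *
        besselD^[k] (fun y => besselj (nuOf d) y ^ n) (x * ρ) =
      besselShift (nuOf d) k * ∫ ρ in Ioi (0 : ℝ), ρ ^ (2 * μ + 1) * Real.exp (-(ρ ^ 2 / 2)) *
        besselMean n d k μ (x * ρ) := by
    rw [← integral_const_mul]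
    refine setIntegral_congr_fun measurableSet_Ioi fun ρ hρ => ?_
    rw [iterate_besselD_besselj_pow hd k (mul_pos hx hρ)]
    ring
  rw [e1, h3, ← integral_const_mul, ← integral_const_mul]
  congr 1
  ext ω
  have hG := Real.Gamma_pos_of_pos (show 0 < nuOf d + k + 1 by positivity)
  rw [besselShift, hμd, Real.rpow_add two_pos, Real.rpow_natCast]
  field_simp

end

/-! ### Mellin transforms of Gaussian averages. -/

/-- The Gaussian as a complex-valued function. -/
noncomputable def cgauss (x : ℝ) : ℂ := ((Real.exp (-(x ^ 2 / 2)) : ℝ) : ℂ)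

theorem continuous_cgauss : Continuous cgauss := by
  unfold cgauss
  fun_prop

theorem mellin_cgauss {s : ℂ} (hs : 0 < s.re) :
    mellin cgauss s = 2 ^ (s / 2 - 1) * Complex.Gamma (s / 2) := by
  have h1 := mellin_comp_rpow (fun t : ℝ => Complex.exp (-((1 / 2 : ℂ) * t))) s 2
  have h2 := Complex.integral_cpow_mul_exp_neg_mul_Ioi (a := s / 2) (r := 1 / 2)
    (by simpa using hs) (by norm_num)
  rw [show (((1 / 2 : ℝ)) : ℂ) = 1 / 2 by push_cast; rfl] at h2
  have h3 : mellin (fun t : ℝ => Complex.exp (-((1 / 2 : ℂ) * t))) (s / 2) =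
      (1 / (1 / 2)) ^ (s / 2) * Complex.Gamma (s / 2) := by rw [← h2]; rfl
  have h4 : cgauss = fun t : ℝ => Complex.exp (-((1 / 2 : ℂ) * ((t ^ (2 : ℝ) : ℝ) : ℂ))) := by
    ext t
    simp only [cgauss, Real.rpow_two]
    push_cast
    congr 1; ring
  rw [h4, h1]
  push_cast
  rw [h3, Complex.cpow_sub _ _ two_ne_zero, Complex.cpow_one, abs_two, one_div_one_div,
    Complex.real_smul]
  push_cast
  ring

theorem mellin_cgauss_ne_zero {s : ℂ} (hs : 0 < s.re) : mellin cgauss s ≠ 0 := by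
  rw [mellin_cgauss hs]
  refine mul_ne_zero ?_ (Complex.Gamma_ne_zero_of_re_pos (by simpa using hs))
  exact fun h => two_ne_zero (Complex.cpow_eq_zero_iff _ _ |>.1 h).1

/-- The Gaussian average `∫ ρ ^ q e^{-ρ²/2} g(x ρ) dρ`. -/
noncomputable def gaussAvg (q : ℝ) (g : ℝ → ℂ) (x : ℝ) : ℂ :=
  ∫ ρ in Ioi (0 : ℝ), ((ρ ^ q : ℝ) : ℂ) * cgauss ρ * g (x * ρ)

/-- For fixed ρ, scaling x reduces the norm integral to `ρ ^ (-Re w)` times that of g. What remains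
is a Gaussian moment of order `q - Re w`, finite by `hq`. -/
theorem integrable_gaussAvg_kernel {g : ℝ → ℂ} (hg : ContinuousOn g (Ioi 0)) {w : ℂ}
    (hw : MellinConvergent g w) {q : ℝ} (hq : -1 < q - w.re) :
    Integrable (fun z : ℝ × ℝ => (z.1 : ℂ) ^ (w - 1) *
      (((z.2 ^ q : ℝ) : ℂ) * cgauss z.2 * g (z.1 * z.2)))
      ((volume.restrict (Ioi 0)).prod (volume.restrict (Ioi 0))) := by
  have hmeas : AEStronglyMeasurable (fun z : ℝ × ℝ => (z.1 : ℂ) ^ (w - 1) *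
      (((z.2 ^ q : ℝ) : ℂ) * cgauss z.2 * g (z.1 * z.2)))
      ((volume.restrict (Ioi 0)).prod (volume.restrict (Ioi 0))) := by
    rw [Measure.prod_restrict]
    refine ContinuousOn.aestronglyMeasurable ?_ (measurableSet_Ioi.prod measurableSet_Ioi)
    refine ContinuousOn.mul ?_ (ContinuousOn.mul (ContinuousOn.mul ?_ ?_) ?_)
    · intro z hz
      have h1 : ContinuousAt (fun z : ℝ × ℝ => (z.1 : ℂ)) z := by fun_prop
      exact (h1.cpow continuousAt_const (Complex.ofReal_mem_slitPlane.2 hz.1)).continuousWithinAt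
    · intro z hz
      have h1 : ContinuousAt (fun z : ℝ × ℝ => z.2 ^ q) z :=
        continuousAt_snd.rpow_const (Or.inl (ne_of_gt hz.2))
      exact (Complex.continuous_ofReal.continuousAt.comp h1).continuousWithinAt
    · exact (continuous_cgauss.comp continuous_snd).continuousOn
    · exact hg.comp (by fun_prop) fun z hz => mul_pos (show 0 < z.1 from hz.1) (show 0 < z.2 from hz.2)
  rw [integrable_prod_iff' hmeas]
  constructor
  · filter_upwards [ae_restrict_mem measurableSet_Ioi] with ρ hρ
    have := (MellinConvergent.comp_mul_left (f := g) (s := w) hρ).2 hw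
    have h2 := this.const_mul (((ρ ^ q : ℝ) : ℂ) * cgauss ρ)
    refine h2.congr (Filter.Eventually.of_forall fun x => ?_)
    simp only [smul_eq_mul]
    rw [mul_comm ρ x]
    ring
  · have h1 : IntegrableOn (fun ρ : ℝ => ρ ^ (q - w.re) * Real.exp (-(ρ ^ 2 / 2)) *
        ∫ x in Ioi (0 : ℝ), ‖(x : ℂ) ^ (w - 1) • g x‖) (Ioi 0) :=
      (integrableOn_rpow_mul_gaussian (q := q - w.re) hq).mul_const _
    refine h1.congr_fun (fun ρ hρ => ?_) measurableSet_Ioi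
    have hρ' : 0 < ρ := hρ
    simp only
    have h2 := integral_comp_mul_left_Ioi (fun x : ℝ => ‖(x : ℂ) ^ (w - 1) • g x‖) 0 hρ'
    rw [mul_zero] at h2
    have h3 : ∀ x ∈ Ioi (0 : ℝ), ‖(x : ℂ) ^ (w - 1) *
        (((ρ ^ q : ℝ) : ℂ) * cgauss ρ * g (x * ρ))‖ = ρ ^ q * Real.exp (-(ρ ^ 2 / 2)) *
          ρ ^ (1 - w.re) * ‖((ρ * x : ℝ) : ℂ) ^ (w - 1) • g (ρ * x)‖ := fun x hx => by
      have hx' : 0 < x := hx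
      rw [norm_smul, norm_mul, norm_mul, norm_mul, cgauss, Complex.norm_real, Complex.norm_real,
        Real.norm_of_nonneg (Real.exp_pos _).le, Real.norm_of_nonneg (by positivity),
        Complex.norm_cpow_eq_rpow_re_of_pos hx', Complex.norm_cpow_eq_rpow_re_of_pos (by positivity),
        Real.mul_rpow hρ'.le hx'.le, mul_comm x ρ]
      have : ρ ^ (1 - w.re) * ρ ^ (w - 1).re = 1 := by
        rw [← Real.rpow_add hρ']; simp
      linear_combination (-(ρ ^ q * Real.exp (-(ρ ^ 2 / 2)) * x ^ (w - 1).re * ‖g (ρ * x)‖)) * this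
    rw [setIntegral_congr_fun measurableSet_Ioi h3, integral_const_mul, h2, smul_eq_mul]
    have h4 : ρ ^ (q - w.re) = ρ ^ q * ρ ^ (1 - w.re) * ρ⁻¹ := by
      rw [← Real.rpow_add hρ', ← Real.rpow_neg_one, ← Real.rpow_add hρ']
      congr 1; ring
    rw [h4]
    ring

theorem mellinConvergent_gaussAvg {g : ℝ → ℂ} (hg : ContinuousOn g (Ioi 0)) {w : ℂ}
    (hw : MellinConvergent g w) {q : ℝ} (hq : -1 < q - w.re) :
    MellinConvergent (gaussAvg q g) w := by
  have h := (integrable_gaussAvg_kernel hg hw hq).integral_prod_left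
  refine h.congr (Filter.Eventually.of_forall fun x => ?_)
  simp only [gaussAvg, smul_eq_mul]
  rw [integral_const_mul]

/-- Gaussian averaging is a multiplicative convolution, hence a product after the Mellin transform;
scaling out ρ leaves `ρ ^ (q - w)`, that is, the argument `q - w + 1`. -/
theorem mellin_gaussAvg {g : ℝ → ℂ} (hg : ContinuousOn g (Ioi 0)) {w : ℂ}
    (hw : MellinConvergent g w) {q : ℝ} (hq : -1 < q - w.re) :
    mellin (gaussAvg q g) w = mellin cgauss (q - w + 1) * mellin g w := by
  have h := integral_integral_swap (f := fun (x ρ : ℝ) => (x : ℂ) ^ (w - 1) *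
    (((ρ ^ q : ℝ) : ℂ) * cgauss ρ * g (x * ρ))) (integrable_gaussAvg_kernel hg hw hq)
  have e1 : mellin (gaussAvg q g) w = ∫ x in Ioi (0 : ℝ), ∫ ρ in Ioi (0 : ℝ), (x : ℂ) ^ (w - 1) *
      (((ρ ^ q : ℝ) : ℂ) * cgauss ρ * g (x * ρ)) := by
    simp only [integral_const_mul]
    rfl
  rw [e1, h, mellin, ← integral_mul_const]
  refine setIntegral_congr_fun measurableSet_Ioi fun ρ hρ => ?_
  have hρ' : 0 < ρ := hρ
  have e2 := mellin_comp_mul_left g w hρ'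
  have e3 : ∫ x in Ioi (0 : ℝ), (x : ℂ) ^ (w - 1) * (((ρ ^ q : ℝ) : ℂ) * cgauss ρ * g (x * ρ)) =
      ((ρ ^ q : ℝ) : ℂ) * cgauss ρ * mellin (fun x => g (ρ * x)) w := by
    rw [mellin, ← integral_const_mul]
    refine integral_congr_ae (Filter.Eventually.of_forall fun x => ?_)
    simp only [smul_eq_mul]
    rw [mul_comm ρ x]
    ring
  rw [e3, e2, smul_eq_mul, smul_eq_mul, add_sub_cancel_right, sub_eq_add_neg (q : ℂ),
    Complex.cpow_add _ _ (by exact_mod_cast hρ'.ne'), Complex.ofReal_cpow hρ'.le]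
  ring

theorem DecayBase.mellin_isBigO {a : ℝ} {g : ℝ → ℝ} (hg : DecayBase a g) (ha : 0 ≤ a) :
    ((fun x => (g x : ℂ)) =O[Filter.atTop] (fun x : ℝ => x ^ (-a))) ∧
    ((fun x => (g x : ℂ)) =O[nhdsWithin 0 (Ioi 0)] (fun x : ℝ => x ^ (-(0 : ℝ)))) := by
  obtain ⟨-, C, hC, h⟩ := hg
  constructor
  · refine Asymptotics.IsBigO.of_bound C ?_
    filter_upwards [Filter.eventually_gt_atTop 0] with x hx
    rw [Complex.norm_real, Real.norm_eq_abs, Real.norm_of_nonneg (by positivity)]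
    refine (h x hx).trans (mul_le_mul_of_nonneg_left ?_ hC)
    exact Real.rpow_le_rpow_of_nonpos hx (by linarith) (by linarith)
  · refine Asymptotics.IsBigO.of_bound C ?_
    filter_upwards [self_mem_nhdsWithin] with x hx
    have hx' : 0 < x := hx
    rw [Complex.norm_real, Real.norm_eq_abs, neg_zero, Real.rpow_zero, norm_one, mul_one]
    refine (h x hx').trans (mul_le_of_le_one_right hC ?_)
    exact Real.rpow_le_one_of_one_le_of_nonpos (by linarith) (by linarith)

theorem DecayBase.continuousOn {a : ℝ} {g : ℝ → ℝ} (hg : DecayBase a g) :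
    ContinuousOn (fun x => (g x : ℂ)) (Ioi 0) :=
  Complex.continuous_ofReal.comp_continuousOn hg.1.continuousOn

theorem DecayBase.mellinConvergent {a : ℝ} {g : ℝ → ℝ} (hg : DecayBase a g) (ha : 0 ≤ a) {w : ℂ}
    (h0 : 0 < w.re) (h1 : w.re < a) : MellinConvergent (fun x => (g x : ℂ)) w :=
  mellinConvergent_of_isBigO_rpow (hg.continuousOn.locallyIntegrableOn measurableSet_Ioi)
    (hg.mellin_isBigO ha).1 h1 (hg.mellin_isBigO ha).2 h0

theorem DecayBase.mellin_differentiableAt {a : ℝ} {g : ℝ → ℝ} (hg : DecayBase a g) (ha : 0 ≤ a)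
    {w : ℂ} (h0 : 0 < w.re) (h1 : w.re < a) :
    DifferentiableAt ℂ (mellin fun x => (g x : ℂ)) w :=
  mellin_differentiableAt_of_isBigO_rpow (hg.continuousOn.locallyIntegrableOn measurableSet_Ioi)
    (hg.mellin_isBigO ha).1 h1 (hg.mellin_isBigO ha).2 h0

/-! ### The formula where the moments are finite. -/

/-- The right-hand side of the moment formula. -/
noncomputable def momentFormula (n d k : ℕ) (s : ℂ) : ℂ :=
  (2 : ℂ) ^ (s - (k : ℂ) + 1) * Complex.Gamma (s / 2 + (nuOf d : ℂ) + 1) /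
    (Complex.Gamma ((nuOf d : ℂ) + 1) * Complex.Gamma ((k : ℂ) - s / 2)) *
      ∫ x in Set.Ioi (0 : ℝ), besselIntegrand n d k s x

/-- `(-(1/x) d/dx)^k j_ν^n` as a complex-valued function. -/
noncomputable def besselIter (n d k : ℕ) (x : ℝ) : ℂ :=
  (((besselD^[k]) (fun y => besselj (nuOf d) y ^ n) x : ℝ) : ℂ)

theorem integral_besselIntegrand (n d k : ℕ) (s : ℂ) :
    ∫ x in Set.Ioi (0 : ℝ), besselIntegrand n d k s x = mellin (besselIter n d k) (2 * k - s) := rfl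

theorem integrableOn_besselIntegrand_iff (n d k : ℕ) (s : ℂ) :
    IntegrableOn (besselIntegrand n d k s) (Ioi 0) ↔
      MellinConvergent (besselIter n d k) (2 * k - s) := Iff.rfl

theorem re_two_mul_sub (k : ℕ) (s : ℂ) : (2 * (k : ℂ) - s).re = 2 * k - s.re := by simp

theorem integrableOn_besselIntegrand {n d k : ℕ} (hd : 2 ≤ d) {s : ℂ}
    (h1 : (k : ℝ) - n * (nuOf d + 1 / 2) < s.re) (h2 : s.re < 2 * k) :
    IntegrableOn (besselIntegrand n d k s) (Ioi 0) := by
  have hν := nuOf_nonneg hd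
  rw [integrableOn_besselIntegrand_iff]
  refine (decay_iterate_besselj_pow hν n k).mellinConvergent (by positivity) ?_ ?_ <;>
  · rw [re_two_mul_sub]; linarith

theorem besselIter_gaussAvg {n d : ℕ} (hd : 2 ≤ d) (k : ℕ) {x : ℝ} (hx : 0 < x) :
    gaussAvg (2 * (nuOf d + k) + 1) (besselIter n d k) x =
      ((2 ^ nuOf d * Real.Gamma (nuOf d + 1) : ℝ) : ℂ) *
        ∫ ω, ((walkDist n d ω ^ (2 * k) : ℝ) : ℂ) * cgauss (x * walkDist n d ω)
          ∂walkMeasure n d := by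
  have h := congrArg (fun y : ℝ => (y : ℂ)) (integral_gaussian_iterate (n := n) hd k hx)
  simp only [Complex.ofReal_mul (2 ^ nuOf d * Real.Gamma (nuOf d + 1)), ← integral_complex_ofReal] at h
  simp only [Complex.ofReal_mul] at h ⊢
  exact h

/-- Both sides of `besselIter_gaussAvg` are Mellin transformed at `w = 2k - s`. For each outcome
with |X| > 0, scaling turns the Gaussian in `x |X|` into a nonzero constant times `|X| ^ (2k - w) =
|X| ^ s`. -/
theorem integrable_walkDist_cpow_and_integral {n d : ℕ} (hn : 2 ≤ n) (hd : 2 ≤ d) {k : ℕ} {s : ℂ}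
    (h1 : (k : ℝ) - n * (nuOf d + 1 / 2) < s.re) (h2 : s.re < 2 * k) (h3 : -(d : ℝ) < s.re) :
    Integrable (fun ω => (walkDist n d ω : ℂ) ^ s) (walkMeasure n d) ∧
      ∫ ω, (walkDist n d ω : ℂ) ^ s ∂walkMeasure n d = momentFormula n d k s := by
  have : NeZero d := ⟨by omega⟩
  have hν := nuOf_nonneg hd
  have hνd : 2 * nuOf d + 2 = d := by unfold nuOf; ring
  set w : ℂ := 2 * k - s with hw
  have hwre : w.re = 2 * k - s.re := re_two_mul_sub k s
  have hw0 : 0 < w.re := by linarith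
  have hgc : ContinuousOn (besselIter n d k) (Ioi 0) :=
    (decay_iterate_besselj_pow hν n k).continuousOn
  have hg : MellinConvergent (besselIter n d k) w := integrableOn_besselIntegrand hd h1 h2
  set q : ℝ := 2 * (nuOf d + k) + 1 with hq
  -- This condition is exactly `Re s > -d`.
  have hqw : -1 < q - w.re := by linarith
  have hM := mellinConvergent_gaussAvg hgc hg hqw
  have hM2 := mellin_gaussAvg hgc hg hqw
  set c : ℝ := 2 ^ nuOf d * Real.Gamma (nuOf d + 1) with hc
  have hc0 : 0 < c := by
    have := Real.Gamma_pos_of_pos (show 0 < nuOf d + 1 by positivity)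
    positivity
  have hc0' : (c : ℂ) ≠ 0 := by exact_mod_cast hc0.ne'
  set r := walkDist n d
  set P := walkMeasure n d
  have hrc : Continuous r := continuous_walkDist n d
  set H : ℝ → (Fin n → UnitSphere d) → ℂ := fun x ω =>
    (x : ℂ) ^ (w - 1) * (((r ω ^ (2 * k) : ℝ) : ℂ) * cgauss (x * r ω)) with hH
  have hcg := continuous_cgauss
  have hi : Integrable (Function.uncurry H) ((volume.restrict (Ioi 0)).prod P) := by
    have hm : AEStronglyMeasurable (Function.uncurry H) ((volume.restrict (Ioi 0)).prod P) := by
      refine AEStronglyMeasurable.mul ?_ (Continuous.aestronglyMeasurable (by fun_prop))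
      refine AEStronglyMeasurable.comp_fst (f := fun x : ℝ => (x : ℂ) ^ (w - 1)) ?_
      refine Measurable.aestronglyMeasurable ?_
      fun_prop
    rw [integrable_prod_iff hm]
    constructor
    · refine Filter.Eventually.of_forall fun x => ?_
      suffices h : Integrable (fun ω => ((r ω ^ (2 * k) : ℝ) : ℂ) * cgauss (x * r ω)) P from
        h.const_mul ((x : ℂ) ^ (w - 1))
      refine Integrable.of_bound (C := (n : ℝ) ^ (2 * k)) (Continuous.aestronglyMeasurable (by fun_prop))
        (Filter.Eventually.of_forall fun ω => ?_)
      rw [norm_mul, Complex.norm_real, cgauss, Complex.norm_real,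
        Real.norm_of_nonneg (Real.exp_pos _).le]
      refine (mul_le_of_le_one_right (norm_nonneg _) ?_).trans (abs_walkDist_pow_le _ _)
      exact Real.exp_le_one_iff.2 (by have := sq_nonneg (x * r ω); linarith)
    -- Positivity is decisive: the expectation of the norm is the norm of the expectation, so the
    -- convergent Mellin integral of the average supplies absolute integrability on the product.
    · have hn1 := hM.norm.mul_const c⁻¹
      refine hn1.congr ?_
      filter_upwards [ae_restrict_mem measurableSet_Ioi] with x hx
      rw [besselIter_gaussAvg hd k hx, norm_smul, norm_mul, Complex.norm_real,
        Real.norm_of_nonneg hc0.le]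
      simp only [Function.uncurry, hH, norm_mul]
      have e1 : ∀ ω, ‖((r ω ^ (2 * k) : ℝ) : ℂ)‖ * ‖cgauss (x * r ω)‖ =
          r ω ^ (2 * k) * Real.exp (-((x * r ω) ^ 2 / 2)) := fun ω => by
        rw [cgauss, Complex.norm_real, Complex.norm_real, Real.norm_of_nonneg (Real.exp_pos _).le,
          Real.norm_of_nonneg (pow_nonneg (walkDist_nonneg ω) _)]
      have e2 : ∫ ω, ((r ω ^ (2 * k) : ℝ) : ℂ) * cgauss (x * r ω) ∂P =
          ((∫ ω, r ω ^ (2 * k) * Real.exp (-((x * r ω) ^ 2 / 2)) ∂P : ℝ) : ℂ) := by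
        rw [← integral_complex_ofReal]
        simp only [cgauss, Complex.ofReal_mul]
      rw [e2, Complex.norm_real, Real.norm_of_nonneg (integral_nonneg fun ω =>
        mul_nonneg (pow_nonneg (walkDist_nonneg ω) _) (Real.exp_pos _).le)]
      simp only [e1]
      rw [integral_const_mul]
      field_simp
      rfl
  have e1 : ∀ᵐ ω ∂P, ∫ x in Ioi (0 : ℝ), H x ω = mellin cgauss w * (r ω : ℂ) ^ s := by
    filter_upwards [ae_walkDist_pos hn hd] with ω hω
    have h := mellin_comp_mul_left cgauss w hω
    have hr0 : (r ω : ℂ) ≠ 0 := by exact_mod_cast hω.ne'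
    calc ∫ x in Ioi (0 : ℝ), H x ω
        = ((r ω ^ (2 * k) : ℝ) : ℂ) * mellin (fun x => cgauss (r ω * x)) w := by
          rw [mellin, ← integral_const_mul]
          refine integral_congr_ae (Filter.Eventually.of_forall fun x => ?_)
          simp only [hH, smul_eq_mul]
          rw [mul_comm x]
          ring
      _ = _ := by
          rw [h, smul_eq_mul, hw, neg_sub, Complex.cpow_sub _ _ hr0]
          rw [show (2 * (k : ℂ)) = ((2 * k : ℕ) : ℂ) by push_cast; rfl, Complex.cpow_natCast]
          push_cast
          field_simp
  have hG0 := mellin_cgauss_ne_zero hw0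
  have hint : Integrable (fun ω => (r ω : ℂ) ^ s) P := by
    have := (hi.integral_prod_right.congr e1).const_mul (mellin cgauss w)⁻¹
    refine this.congr (Filter.Eventually.of_forall fun ω => ?_)
    simp only
    rw [inv_mul_cancel_left₀ hG0]
  refine ⟨hint, ?_⟩
  have h4 := integral_integral_swap hi
  rw [integral_congr_ae e1, integral_const_mul] at h4
  have h5 : mellin (gaussAvg q (besselIter n d k)) w = c * ∫ x in Ioi (0 : ℝ), ∫ ω, H x ω ∂P := by
    rw [mellin, ← integral_const_mul]
    refine setIntegral_congr_fun measurableSet_Ioi fun x hx => ?_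
    simp only [hH]
    rw [besselIter_gaussAvg hd k hx, integral_const_mul, smul_eq_mul]
    ring
  rw [h4, hM2] at h5
  rw [momentFormula, integral_besselIntegrand]
  have hqw' : (0 : ℝ) < ((q : ℂ) - w + 1).re := by simp; linarith
  rw [mellin_cgauss hw0, mellin_cgauss hqw'] at h5
  have e3 : ((q : ℂ) - w + 1) / 2 = s / 2 + nuOf d + 1 := by
    rw [hw, hq]; push_cast; ring
  have e4 : w / 2 = k - s / 2 := by rw [hw]; ring
  have hG1 : Complex.Gamma (k - s / 2) ≠ 0 := by
    rw [← e4]; exact Complex.Gamma_ne_zero_of_re_pos (by simpa using hw0)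
  have hG2 : Complex.Gamma ((nuOf d : ℂ) + 1) ≠ 0 :=
    Complex.Gamma_ne_zero_of_re_pos (by simp; linarith)
  rw [e3, e4, hc, Complex.ofReal_mul, ← Complex.Gamma_ofReal, Complex.ofReal_cpow two_pos.le] at h5
  push_cast at h5
  have e5 : (2 : ℂ) ^ (s - k + 1) * (2 ^ (nuOf d : ℂ) * 2 ^ (k - s / 2 - 1)) =
      2 ^ (s / 2 + nuOf d + 1 - 1) := by
    rw [← Complex.cpow_add _ _ two_ne_zero, ← Complex.cpow_add _ _ two_ne_zero]
    congr 1; ring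
  have hp1 : (2 : ℂ) ^ (nuOf d : ℂ) ≠ 0 := fun h => two_ne_zero (Complex.cpow_eq_zero_iff _ _ |>.1 h).1
  have hp2 : (2 : ℂ) ^ (k - s / 2 - 1) ≠ 0 := fun h => two_ne_zero (Complex.cpow_eq_zero_iff _ _ |>.1 h).1
  rw [← e5] at h5
  rw [div_mul_eq_mul_div, eq_div_iff (mul_ne_zero hG2 hG1)]
  apply mul_left_cancel₀ (mul_ne_zero hp1 hp2)
  linear_combination -h5

/-! ### The moment function as a complex moment generating function. -/

section
open ProbabilityTheory Filter
open scoped Topology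

/-- Two meromorphic functions on a preconnected set which agree near one of its points agree near
all of its points. -/
theorem MeromorphicOn.eventuallyEq_of_isPreconnected {f g : ℂ → ℂ} {V : Set ℂ}
    (hf : MeromorphicOn f V) (hg : MeromorphicOn g V) (hV : IsPreconnected V) {z₀ z : ℂ}
    (hz₀ : z₀ ∈ V) (hz : z ∈ V) (h : f =ᶠ[𝓝[≠] z₀] g) : f =ᶠ[𝓝[≠] z] g := by
  have key : meromorphicOrderAt (f - g) z = ⊤ := by
    by_contra hne
    refine (hf.sub hg).meromorphicOrderAt_ne_top_of_isPreconnected hV hz hz₀ hne ?_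
    rw [meromorphicOrderAt_eq_top_iff]
    filter_upwards [h] with y hy
    simp [hy]
  rw [meromorphicOrderAt_eq_top_iff] at key
  filter_upwards [key] with y hy
  exact sub_eq_zero.1 hy

theorem isPreconnected_re_Ioi (a : ℝ) : IsPreconnected {s : ℂ | a < s.re} :=
  (convex_halfSpace_re_gt a).isPreconnected

theorem isOpen_re_gt (a : ℝ) : IsOpen {s : ℂ | a < s.re} :=
  isOpen_lt continuous_const Complex.continuous_re

theorem isOpen_re_lt (a : ℝ) : IsOpen {s : ℂ | s.re < a} :=
  isOpen_lt Complex.continuous_re continuous_const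

/-- The logarithm of the distance travelled. -/
noncomputable def logDist (n d : ℕ) (ω : Fin n → UnitSphere d) : ℝ := Real.log (walkDist n d ω)

/-- The moment function where the moments are finite. -/
noncomputable def walkMoment (n d : ℕ) : ℂ → ℂ := complexMGF (logDist n d) (walkMeasure n d)

theorem measurable_logDist (n d : ℕ) : Measurable (logDist n d) :=
  Real.measurable_log.comp (measurable_walkDist n d)

theorem cexp_logDist_ae {n d : ℕ} (hn : 2 ≤ n) (hd : 2 ≤ d) (s : ℂ) :
    (fun ω => Complex.exp (s * logDist n d ω)) =ᵐ[walkMeasure n d]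
      fun ω => (walkDist n d ω : ℂ) ^ s := by
  filter_upwards [ae_walkDist_pos hn hd] with ω hω
  rw [Complex.cpow_def_of_ne_zero (by exact_mod_cast hω.ne'), logDist, Complex.ofReal_log hω.le,
    mul_comm]

theorem walkMoment_eq {n d : ℕ} (hn : 2 ≤ n) (hd : 2 ≤ d) (s : ℂ) :
    walkMoment n d s = ∫ ω, (walkDist n d ω : ℂ) ^ s ∂walkMeasure n d :=
  integral_congr_ae (cexp_logDist_ae hn hd s)

theorem integrable_walkDist_cpow_iff {n d : ℕ} (hn : 2 ≤ n) (hd : 2 ≤ d) (s : ℂ) :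
    Integrable (fun ω => (walkDist n d ω : ℂ) ^ s) (walkMeasure n d) ↔
      s.re ∈ integrableExpSet (logDist n d) (walkMeasure n d) := by
  have hm := measurable_logDist n d
  rw [← integrable_congr (cexp_logDist_ae hn hd s), integrableExpSet, mem_ofPred_eq,
    ← integrable_norm_iff (by fun_prop)]
  refine integrable_congr (Eventually.of_forall fun ω => ?_)
  simp [Complex.norm_exp]

/-- Change of variables from the density to the walk. Restricting to positive `x` loses nothing, as
the distance is almost surely positive. -/
theorem momentIntegrand_integrable_and_integral {n d : ℕ} (hn : 2 ≤ n) (hd : 2 ≤ d) (s : ℂ) :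
    (IntegrableOn (momentIntegrand n d s) (Ioi 0) ↔
      s.re ∈ integrableExpSet (logDist n d) (walkMeasure n d)) ∧
    ∫ x in Ioi (0 : ℝ), momentIntegrand n d s x = walkMoment n d s := by
  have : NeZero d := ⟨by omega⟩
  have hpdf := hasPDF_walkDist hn hd
  set h : ℝ → ℂ := (Ioi 0).indicator fun x => (x : ℂ) ^ s with hh
  have hm : AEStronglyMeasurable h volume := by
    refine Measurable.aestronglyMeasurable (Measurable.indicator ?_ measurableSet_Ioi)
    fun_prop
  have e1 : (Ioi (0 : ℝ)).indicator (momentIntegrand n d s) =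
      fun x => (pdf (walkDist n d) (walkMeasure n d) volume x).toReal • h x := by
    ext x
    by_cases hx : x ∈ Ioi (0 : ℝ)
    · simp only [hh, indicator_of_mem hx, momentIntegrand, walkDensity, Complex.real_smul]
      ring
    · simp [hh, indicator_of_notMem hx]
  have e2 : (fun ω => h (walkDist n d ω)) =ᵐ[walkMeasure n d] fun ω => (walkDist n d ω : ℂ) ^ s := by
    filter_upwards [ae_walkDist_pos hn hd] with ω hω
    simp only [hh]
    rw [indicator_of_mem (mem_Ioi.2 hω)]
  constructor
  · rw [← integrable_indicator_iff measurableSet_Ioi, e1, pdf.integrable_pdf_smul_iff hm,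
      integrable_congr e2, integrable_walkDist_cpow_iff hn hd]
  · rw [← integral_indicator measurableSet_Ioi, e1, pdf.integral_pdf_smul hm, integral_congr_ae e2,
      walkMoment_eq hn hd]

theorem mem_integrableExpSet_of_nonneg {n d : ℕ} (hn : 2 ≤ n) (hd : 2 ≤ d) {σ : ℝ} (hσ : 0 ≤ σ) :
    σ ∈ integrableExpSet (logDist n d) (walkMeasure n d) := by
  have : NeZero d := ⟨by omega⟩
  have hm := measurable_logDist n d
  refine Integrable.of_bound (C := (n : ℝ) ^ σ) (by fun_prop) ?_
  filter_upwards [ae_walkDist_pos hn hd] with ω hω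
  rw [Real.norm_of_nonneg (Real.exp_pos _).le, logDist, mul_comm, ← Real.rpow_def_of_pos hω]
  exact Real.rpow_le_rpow hω.le (walkDist_le ω) hσ

/-- The set of admissible exponents is convex and contains all nonnegative reals, as the distance is
bounded; hence it is closed upwards. -/
theorem mem_integrableExpSet_of_le {n d : ℕ} (hn : 2 ≤ n) (hd : 2 ≤ d) {σ τ : ℝ}
    (h : σ ∈ integrableExpSet (logDist n d) (walkMeasure n d)) (hστ : σ ≤ τ) :
    τ ∈ integrableExpSet (logDist n d) (walkMeasure n d) :=
  convex_integrableExpSet.ordConnected.out h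
    (mem_integrableExpSet_of_nonneg hn hd (le_max_right τ 0)) ⟨hστ, le_max_left τ 0⟩

theorem analyticAt_walkMoment {n d : ℕ} (hn : 2 ≤ n) (hd : 2 ≤ d) {σ : ℝ} {s : ℂ}
    (h : σ ∈ integrableExpSet (logDist n d) (walkMeasure n d)) (hs : σ < s.re) :
    AnalyticAt ℂ (walkMoment n d) s := by
  refine analyticAt_complexMGF (mem_interior.2 ⟨Ioi σ, fun τ hτ => ?_, isOpen_Ioi, hs⟩)
  exact mem_integrableExpSet_of_le hn hd h (le_of_lt hτ)

/-- Covers an exponent on the boundary of the convergence region, where analyticity is not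
available. For 0 < ε < 1 the integrand is dominated by the exponent `Re s` where the distance is at
most 1 and by `Re s + 1` where it is at least 1. -/
theorem tendsto_walkMoment {n d : ℕ} (hn : 2 ≤ n) (hd : 2 ≤ d) {s : ℂ}
    (h : s.re ∈ integrableExpSet (logDist n d) (walkMeasure n d)) :
    Tendsto (fun ε : ℝ => walkMoment n d (s + ε)) (𝓝[>] 0) (𝓝 (walkMoment n d s)) := by
  have hm := measurable_logDist n d
  have h1 : s.re + 1 ∈ integrableExpSet (logDist n d) (walkMeasure n d) :=
    mem_integrableExpSet_of_le hn hd h (by linarith)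
  refine tendsto_integral_filter_of_dominated_convergence
    (fun ω => Real.exp (s.re * logDist n d ω) + Real.exp ((s.re + 1) * logDist n d ω))
    (Eventually.of_forall fun ε => ?_) ?_ (Integrable.add h h1) (Eventually.of_forall fun ω => ?_)
  · exact Measurable.aestronglyMeasurable (by fun_prop)
  · filter_upwards [Ioo_mem_nhdsGT one_pos] with ε hε
    refine Eventually.of_forall fun ω => ?_
    rw [Complex.norm_exp]
    have : ((s + ε) * (logDist n d ω : ℂ)).re = (s.re + ε) * logDist n d ω := by simp
    rw [this]
    rcases le_total 0 (logDist n d ω) with hl | hl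
    · refine le_add_of_nonneg_of_le (Real.exp_pos _).le (Real.exp_le_exp.2 ?_)
      nlinarith [hε.2]
    · refine le_add_of_le_of_nonneg (Real.exp_le_exp.2 ?_) (Real.exp_pos _).le
      nlinarith [hε.1]
  · have : Continuous fun ε : ℝ => Complex.exp ((s + ε) * logDist n d ω) := by fun_prop
    have h2 := (this.tendsto 0).mono_left (nhdsWithin_le_nhds (s := Ioi 0))
    simpa using h2

end

/-! ### Meromorphic continuation and the identity theorem. -/

section
open ProbabilityTheory Filter
open scoped Topology

theorem walkMoment_eq_momentFormula {n d : ℕ} (hn : 2 ≤ n) (hd : 2 ≤ d) {k : ℕ} {s : ℂ}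
    (h1 : (k : ℝ) - n * (nuOf d + 1 / 2) < s.re) (h2 : s.re < 2 * k) (h3 : -(d : ℝ) < s.re) :
    s.re ∈ integrableExpSet (logDist n d) (walkMeasure n d) ∧
      walkMoment n d s = momentFormula n d k s := by
  obtain ⟨h, h'⟩ := integrable_walkDist_cpow_and_integral hn hd h1 h2 h3
  exact ⟨(integrable_walkDist_cpow_iff hn hd s).1 h, (walkMoment_eq hn hd s).trans h'⟩

/-- An abscissa to the right of which all moments are finite. -/
noncomputable def momentAbscissa (n d : ℕ) : ℝ := max (-(d : ℝ)) (-(n * (nuOf d + 1 / 2)))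

theorem momentAbscissa_neg {n d : ℕ} (hn : 2 ≤ n) (hd : 2 ≤ d) : momentAbscissa n d < 0 := by
  have hν := nuOf_nonneg hd
  have h1 : (2 : ℝ) ≤ n := by exact_mod_cast hn
  have h2 : (2 : ℝ) ≤ d := by exact_mod_cast hd
  refine max_lt (by linarith) (neg_lt_zero.2 (by positivity))

theorem mem_integrableExpSet_of_abscissa {n d : ℕ} (hn : 2 ≤ n) (hd : 2 ≤ d) {σ : ℝ}
    (h : momentAbscissa n d < σ) : σ ∈ integrableExpSet (logDist n d) (walkMeasure n d) := by
  rcases le_or_gt 0 σ with h0 | h0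
  · exact mem_integrableExpSet_of_nonneg hn hd h0
  · have h1 := (le_max_left _ _).trans_lt h
    have h2 := (le_max_right _ _).trans_lt h
    have := (walkMoment_eq_momentFormula hn hd (k := 0) (s := (σ : ℂ))
      (by simpa using h2) (by simpa using h0) (by simpa using h1)).1
    simpa using this

theorem analyticAt_walkMoment_of_abscissa {n d : ℕ} (hn : 2 ≤ n) (hd : 2 ≤ d) {s : ℂ}
    (h : momentAbscissa n d < s.re) : AnalyticAt ℂ (walkMoment n d) s := by
  obtain ⟨σ, h1, h2⟩ := exists_between h
  exact analyticAt_walkMoment hn hd (mem_integrableExpSet_of_abscissa hn hd h1) h2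

theorem analyticAt_mellin_besselIter {n d k : ℕ} (hd : 2 ≤ d) {s : ℂ}
    (h1 : (k : ℝ) - n * (nuOf d + 1 / 2) < s.re) (h2 : s.re < 2 * k) :
    AnalyticAt ℂ (fun s => ∫ x in Ioi (0 : ℝ), besselIntegrand n d k s x) s := by
  have hν := nuOf_nonneg hd
  have ho : IsOpen {s : ℂ | (k : ℝ) - n * (nuOf d + 1 / 2) < s.re ∧ s.re < 2 * k} :=
    (isOpen_re_gt _).inter (isOpen_re_lt _)
  refine DifferentiableOn.analyticAt (s := _) (fun z hz => ?_) (ho.mem_nhds ⟨h1, h2⟩)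
  have hd1 : DifferentiableAt ℂ (mellin (besselIter n d k)) (2 * k - z) :=
    (decay_iterate_besselj_pow hν n k).mellin_differentiableAt (by positivity)
      (by rw [re_two_mul_sub]; linarith [hz.2]) (by rw [re_two_mul_sub]; linarith [hz.1])
  have hd2 : DifferentiableAt ℂ (fun z : ℂ => 2 * (k : ℂ) - z) z := by fun_prop
  exact (hd1.comp z hd2).differentiableWithinAt

theorem analyticAt_gamma {s : ℂ} (h : ∀ m : ℕ, s ≠ -m) : AnalyticAt ℂ Complex.Gamma s := by
  have h0 : Complex.Gamma s ≠ 0 := Complex.Gamma_ne_zero h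
  have := (Complex.analyticOnNhd_univ_iff_differentiable.mpr Complex.differentiable_one_div_Gamma) s
    (mem_univ s)
  have e : (fun s => (Complex.Gamma s)⁻¹)⁻¹ = Complex.Gamma := by
    ext z
    simp
  exact e ▸ this.inv (inv_ne_zero h0)

theorem analyticAt_cpow_two (k : ℕ) (s : ℂ) : AnalyticAt ℂ (fun s : ℂ => (2 : ℂ) ^ (s - k + 1)) s := by
  refine (Complex.analyticOnNhd_univ_iff_differentiable.mpr fun z => ?_) s (mem_univ s)
  exact DifferentiableAt.const_cpow (by fun_prop) (Or.inl two_ne_zero)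

theorem analyticAt_gamma_denominator {d k : ℕ} (hd : 2 ≤ d) {s : ℂ} (h2 : s.re < 2 * k) :
    AnalyticAt ℂ (fun s : ℂ => (Complex.Gamma ((nuOf d : ℂ) + 1) * Complex.Gamma (k - s / 2))⁻¹) s := by
  have hν := nuOf_nonneg hd
  have hre : 0 < ((k : ℂ) - s / 2).re := by simp; linarith
  have h0 : ∀ m : ℕ, (k : ℂ) - s / 2 ≠ -m := fun m h => by
    rw [h] at hre
    have : (0 : ℝ) ≤ m := m.cast_nonneg
    simp at hre
    linarith
  have h3 : AnalyticAt ℂ (fun s : ℂ => Complex.Gamma (k - s / 2)) s :=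
    AnalyticAt.fun_comp (f := fun s : ℂ => (k : ℂ) - s / 2) (analyticAt_gamma h0) (by fun_prop)
  refine (analyticAt_const.mul h3).inv (mul_ne_zero ?_ (Complex.Gamma_ne_zero h0))
  exact Complex.Gamma_ne_zero_of_re_pos (by simp; linarith)

theorem meromorphicAt_momentFormula {n d k : ℕ} (hd : 2 ≤ d) {s : ℂ}
    (h1 : (k : ℝ) - n * (nuOf d + 1 / 2) < s.re) (h2 : s.re < 2 * k) :
    MeromorphicAt (momentFormula n d k) s := by
  have hG : MeromorphicAt (fun s : ℂ => Complex.Gamma (s / 2 + (nuOf d : ℂ) + 1)) s :=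
    MeromorphicAt.comp_analyticAt (f := Complex.Gamma) (g := fun s : ℂ => s / 2 + (nuOf d : ℂ) + 1)
      (Meromorphic.Gamma _) (by fun_prop)
  have := (((analyticAt_cpow_two k s).meromorphicAt.mul hG).mul
    (analyticAt_gamma_denominator hd h2).meromorphicAt).mul
      (analyticAt_mellin_besselIter (n := n) hd h1 h2).meromorphicAt
  exact this

theorem analyticAt_momentFormula {n d k : ℕ} (hd : 2 ≤ d) {s : ℂ}
    (h1 : (k : ℝ) - n * (nuOf d + 1 / 2) < s.re) (h2 : s.re < 2 * k)
    (h3 : ∀ m : ℕ, s ≠ -((d : ℂ) + 2 * (m : ℂ))) :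
    AnalyticAt ℂ (momentFormula n d k) s := by
  have hG : AnalyticAt ℂ (fun s : ℂ => Complex.Gamma (s / 2 + (nuOf d : ℂ) + 1)) s := by
    refine AnalyticAt.fun_comp (f := fun s : ℂ => s / 2 + (nuOf d : ℂ) + 1)
      (analyticAt_gamma fun m hm => h3 m ?_) (by fun_prop)
    -- As ν + 1 = d/2, a pole of the Gamma factor means `s = -d - 2m`.
    unfold nuOf at hm
    push_cast at hm
    linear_combination 2 * hm
  exact (((analyticAt_cpow_two k s).mul hG).mul
    (analyticAt_gamma_denominator hd h2)).mul (analyticAt_mellin_besselIter (n := n) hd h1 h2)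

/-- A function in normal form on the half-plane which continues the moment function takes its
values wherever the moments are finite. -/
theorem eq_walkMoment_of_eventuallyEq {n d : ℕ} (hn : 2 ≤ n) (hd : 2 ≤ d) {W : ℂ → ℂ}
    (hW : MeromorphicNFOn W (momentHalfPlane n d))
    (hg : ∀ s : ℂ, momentAbscissa n d < s.re → W =ᶠ[𝓝[≠] s] walkMoment n d)
    {s : ℂ} (hs : s ∈ momentHalfPlane n d)
    (hi : s.re ∈ integrableExpSet (logDist n d) (walkMeasure n d)) :
    W s = walkMoment n d s := by
  have hneg := momentAbscissa_neg hn hd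
  -- Strictly to the right of `s` the moment function is analytic, so the identity theorem applies,
  -- starting from a point with real part at least 1.
  have heq : ∀ z : ℂ, s.re < z.re → W z = walkMoment n d z := by
    intro z hz
    have hsub : {z : ℂ | s.re < z.re} ⊆ momentHalfPlane n d := fun z hz =>
      lt_trans (show -((n : ℝ) * (nuOf d + 1 / 2)) < s.re from hs) hz
    have han : ∀ z ∈ {z : ℂ | s.re < z.re}, AnalyticAt ℂ (walkMoment n d) z := fun z hz =>
      analyticAt_walkMoment hn hd hi hz
    have hz₀ : ((max s.re 0 + 1 : ℝ) : ℂ) ∈ {z : ℂ | s.re < z.re} := by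
      change s.re < ((max s.re 0 + 1 : ℝ) : ℂ).re
      rw [Complex.ofReal_re]
      linarith [le_max_left s.re 0]
    have h := MeromorphicOn.eventuallyEq_of_isPreconnected
      (fun z hz => (hW (hsub hz)).meromorphicAt) (fun z hz => (han z hz).meromorphicAt)
      (isPreconnected_re_Ioi s.re) hz₀ hz (hg _ (by
        rw [Complex.ofReal_re]; linarith [le_max_right s.re 0]))
    exact (((hW (hsub hz)).eventuallyEq_nhdsNE_iff_eventuallyEq_nhds
      (han z hz).meromorphicNFAt).1 h).eq_of_nhds
  have hlim : Tendsto (fun ε : ℝ => W (s + ε)) (𝓝[>] 0) (𝓝 (walkMoment n d s)) := by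
    refine (tendsto_walkMoment hn hd hi).congr' ?_
    filter_upwards [self_mem_nhdsWithin] with ε hε
    have hε' : 0 < ε := hε
    exact (heq _ (by simpa using hε')).symm
  have hpath : Tendsto (fun ε : ℝ => s + ε) (𝓝[>] 0) (𝓝[≠] s) := by
    refine tendsto_nhdsWithin_iff.2 ⟨?_, ?_⟩
    · have : Continuous fun ε : ℝ => s + (ε : ℂ) := by fun_prop
      have h2 := (this.tendsto 0).mono_left (nhdsWithin_le_nhds (s := Ioi 0))
      simpa using h2
    · filter_upwards [self_mem_nhdsWithin] with ε hε
      have hε' : (0 : ℝ) < ε := hε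
      simp [hε'.ne']
  -- In normal form `W` is either analytic at `s`, hence equal to its limit from the right, or has a
  -- pole there, which that finite limit excludes.
  rcases meromorphicNFAt_iff_analyticAt_or.1 (hW hs) with h | ⟨-, h, -⟩
  · exact tendsto_nhds_unique
      (h.continuousAt.tendsto.comp (hpath.mono_right nhdsWithin_le_nhds)) hlim
  · exact absurd hlim (((tendsto_cobounded_of_meromorphicOrderAt_neg h).comp hpath).not_tendsto
      (Metric.disjoint_nhds_cobounded _).symm)

/-- The moments, right of the abscissa, are glued to the formula with `k = 0`, valid for negative
real part. The abscissa is negative, so the two regions overlap and cover the half-plane; on the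
overlap the functions agree. -/
theorem exists_isMomentFunction {n d : ℕ} (hn : 2 ≤ n) (hd : 2 ≤ d) :
    ∃ W : ℂ → ℂ, IsMomentFunction n d W := by
  have hneg := momentAbscissa_neg hn hd
  classical
  set W₀ : ℂ → ℂ := fun s =>
    if momentAbscissa n d < s.re then walkMoment n d s else momentFormula n d 0 s with hW₀
  have hright : ∀ s : ℂ, momentAbscissa n d < s.re → W₀ =ᶠ[𝓝 s] walkMoment n d := fun s hs => by
    filter_upwards [(isOpen_re_gt (momentAbscissa n d)).mem_nhds hs] with z hz
    exact if_pos hz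
  have hmer : MeromorphicOn W₀ (momentHalfPlane n d) := by
    intro s hs
    by_cases h : momentAbscissa n d < s.re
    · exact ((analyticAt_walkMoment_of_abscissa hn hd h).congr (hright s h).symm).meromorphicAt
    · have hs0 : s.re < 0 := lt_of_le_of_lt (not_lt.1 h) hneg
      have hs' : -(n * (nuOf d + 1 / 2)) < s.re := hs
      have he : W₀ =ᶠ[𝓝 s] momentFormula n d 0 := by
        filter_upwards [(isOpen_re_lt 0).mem_nhds hs0] with z hz
        by_cases hz' : momentAbscissa n d < z.re
        · have h1 := (le_max_left _ _).trans_lt hz'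
          have h2 := (le_max_right _ _).trans_lt hz'
          simp only [hW₀, if_pos hz']
          exact (walkMoment_eq_momentFormula hn hd (by simpa using h2) (by simpa using hz) h1).2
        · exact if_neg hz'
      exact (meromorphicAt_momentFormula hd (by simpa using hs') (by simpa using hs0)).congr
        (he.symm.filter_mono nhdsWithin_le_nhds)
  refine ⟨toMeromorphicNFOn W₀ (momentHalfPlane n d), meromorphicNFOn_toMeromorphicNFOn _ _,
    fun s hs hi => ?_⟩
  obtain ⟨h1, h2⟩ := momentIntegrand_integrable_and_integral hn hd s
  rw [h2]
  refine eq_walkMoment_of_eventuallyEq hn hd (meromorphicNFOn_toMeromorphicNFOn _ _)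
    (fun z hz => ?_) hs (h1.1 hi)
  have hzU : z ∈ momentHalfPlane n d := (le_max_right _ _).trans_lt hz
  exact (hmer.toMeromorphicNFOn_eq_self_on_nhdsNE hzU).trans
    ((hright z hz).filter_mono nhdsWithin_le_nhds)

/-- The strip is connected and its part with `Re z > -d`, where the formula is already known, is
nonempty. The identity theorem reaches `s`, and the normal form of `W` with analyticity of the
formula off the poles upgrades agreement near `s` to equality at `s`. -/
theorem IsMomentFunction.eq_momentFormula {n d : ℕ} (hn : 2 ≤ n) (hd : 2 ≤ d) {W : ℂ → ℂ}
    (hW : IsMomentFunction n d W) {k : ℕ} {s : ℂ}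
    (h1 : (k : ℝ) - n * (nuOf d + 1 / 2) < s.re) (h2 : s.re < 2 * k)
    (h3 : ∀ m : ℕ, s ≠ -((d : ℂ) + 2 * (m : ℂ))) :
    W s = momentFormula n d k s := by
  have hk : (0 : ℝ) ≤ k := k.cast_nonneg
  have hd0 : (2 : ℝ) ≤ d := by exact_mod_cast hd
  set a : ℝ := k - n * (nuOf d + 1 / 2) with ha
  set V : Set ℂ := {z | a < z.re ∧ z.re < 2 * k} with hV
  have hVU : V ⊆ momentHalfPlane n d := fun z hz => by
    change -(n * (nuOf d + 1 / 2)) < z.re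
    linarith [hz.1]
  have hVc : IsPreconnected V :=
    ((convex_halfSpace_re_gt a).inter (convex_halfSpace_re_lt (2 * k))).isPreconnected
  obtain ⟨σ, hσ1, hσ2⟩ := exists_between (max_lt (h1.trans h2) (show -(d : ℝ) < 2 * k by linarith))
  have hO : IsOpen {z : ℂ | max a (-d) < z.re ∧ z.re < 2 * k} :=
    (isOpen_re_gt _).inter (isOpen_re_lt _)
  have hσV : (σ : ℂ) ∈ {z : ℂ | max a (-d) < z.re ∧ z.re < 2 * k} :=
    ⟨by simpa using hσ1, by simpa using hσ2⟩
  have hloc : W =ᶠ[𝓝 (σ : ℂ)] momentFormula n d k := by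
    filter_upwards [hO.mem_nhds hσV] with z hz
    have hz1 := (le_max_left _ _).trans_lt hz.1
    have hz2 := (le_max_right _ _).trans_lt hz.1
    obtain ⟨e1, e2⟩ := walkMoment_eq_momentFormula hn hd hz1 hz.2 hz2
    obtain ⟨e3, e4⟩ := momentIntegrand_integrable_and_integral hn hd z
    rw [hW.2 z (hVU ⟨hz1, hz.2⟩) (e3.2 e1), e4, e2]
  have hnear := MeromorphicOn.eventuallyEq_of_isPreconnected
    (fun z hz => (hW.1 (hVU hz)).meromorphicAt)
    (fun z hz => meromorphicAt_momentFormula (n := n) hd hz.1 hz.2) hVc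
    (show (σ : ℂ) ∈ V from ⟨(le_max_left _ _).trans_lt hσV.1, hσV.2⟩) (show s ∈ V from ⟨h1, h2⟩)
    (hloc.filter_mono nhdsWithin_le_nhds)
  exact (((hW.1 (hVU ⟨h1, h2⟩)).eventuallyEq_nhdsNE_iff_eventuallyEq_nhds
    (analyticAt_momentFormula hd h1 h2 h3).meromorphicNFAt).1 hnear).eq_of_nhds

end

theorem mainTheorem10 (n d : ℕ) (hn : 2 ≤ n) (hd : 2 ≤ d) :
    (∃ W : ℂ → ℂ, IsMomentFunction n d W) ∧
    ∀ W : ℂ → ℂ, IsMomentFunction n d W →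
      ∀ (k : ℕ) (s : ℂ),
        (k : ℝ) - (n : ℝ) * (nuOf d + 1 / 2) < s.re → s.re < 2 * (k : ℝ) →
        IntegrableOn (besselIntegrand n d k s) (Set.Ioi (0 : ℝ)) ∧
        ((∀ m : ℕ, s ≠ -((d : ℂ) + 2 * (m : ℂ))) →
          W s =
            (2 : ℂ) ^ (s - (k : ℂ) + 1) * Complex.Gamma (s / 2 + (nuOf d : ℂ) + 1) /
                (Complex.Gamma ((nuOf d : ℂ) + 1) * Complex.Gamma ((k : ℂ) - s / 2)) *
              ∫ x in Set.Ioi (0 : ℝ), besselIntegrand n d k s x) := by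
  exact ⟨exists_isMomentFunction hn hd, fun W hW k s h1 h2 =>
    ⟨integrableOn_besselIntegrand hd h1 h2, fun h3 => hW.eq_momentFormula hn hd h1 h2 h3⟩⟩
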